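/- Let $\mathfrak{sl}_2$ have standard generators $e,f,h$ with $[h,e]=2e$, $[h,f]=-2f$, $[e,f]=h$ and invariant form $(e,f)=1$, $(h,h)=2$; put $\mathfrak g_0=\mathbb Ch$, $\mathfrak g_1=\mathbb Ce\oplus\mathbb Cf$. The affine Lie algebra $\widehat{\mathfrak{sl}}_2$ in the principal picture is $$\widehat{\mathfrak{sl}}_2=\mathfrak g_0\otimes\mathbb C[t^2,t^{-2}]\ \oplus\ \mathfrak g_1\otimes t\,\mathbb C[t^2,t^{-2}]\ \oplus\ \mathbb Cc\ \oplus\ \mathbb C\rho ,$$ with $c$ central, $[\rho,a\otimes t^m]=m\,a\otimes t^m$ and $[a\otimes t^m,b\otimes t^n]=[a,b]\otimes t^{m+n}+\tfrac12(a,b)\,m\,\delta_{m+n,0}\,c$. Put $\beta_n=(e+f)\otimes t^n$ for $n$ odd, $x_n=h\otimes t^n$ for $n$ even, $x_n=(-e+f)\otimes t^n$ for $n$ odd, and $\beta(\zeta)=\sum_{n\ \mathrm{odd}}\beta_n\zeta^{-n}$, $x(\zeta)=\sum_{n\in\mathbb Z}x_n\zeta^{-n}$. Let $j,k\in\mathbb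 C$ with $k\neq 0,-2$. Let $\phi_{0,n},\phi_{2,n}$ ($n$ odd) and $\phi_{1,n}$ ($n$ even) satisfy $[\phi_{0,m},\phi_{0,n}]=4km\,\delta_{m+n,0}$, $[\phi_{1,m},\phi_{1,n}]=4(k+2)m\,\delta_{m+n,0}$, $[\phi_{2,m},\phi_{2,n}]=-4km\,\delta_{m+n,0}$, all other commutators being $0$. They act on the Fock space $$\mathcal F_{j,k}=\mathbb C[\phi_{0,-n},\phi_{2,-n}\ (n=1,3,5,\dots),\ \phi_{1,-n}\ (n=2,4,6,\dots)]\,|j,k\rangle ,$$ where $\phi_{i,n}|j,k\rangle=0$ for $n>0$ and $\phi_{1,0}|j,k\rangle=2j|j,k\rangle$. Let $d$ be the operator on $\mathcal F_{j,k}$ with $[d,\phi_{i,n}]=-n\phi_{i,n}$ and $d|j,k\rangle=\frac{2j^2+k}{4(k+2)}|j,k\rangle$. With $D=\zeta\frac{d}{d\zeta}$ put $\phi_i(\zeta)=-\sum_{n\ \mathrm{odd}}\frac{\phi_{i,n}}{n}\zeta^{-n}$ for $i=0,2$, so that $D\phi_i(\zeta)=\sum_{n\ \mathrm{odd}}\phi_{i,n}\zeta^{-n}$,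 and $D\phi_1(\zeta)=\sum_{n\ \mathrm{even}}\phi_{1,n}\zeta^{-n}$. Normal ordering $:\ :$ places the operators $\phi_{i,n}$ with $n>0$ to the right. Then there is a unique representation of $\widehat{\mathfrak{sl}}_2$ on $\mathcal F_{j,k}$, and it has level $k$, in which $$\beta(\zeta)=\tfrac12 D\phi_0(\zeta),\qquad x(\zeta)=\tfrac12:\bigl(D\phi_1(\zeta)+D\phi_2(\zeta)\bigr)e^{\phi_2(\zeta)/k+\phi_0(\zeta)/k}:\,,\qquad c=k,\qquad \rho=-d .$$ In particular, with $\delta(z)=\sum_{m\in\mathbb Z}z^m$ and $(D\delta)(z)=\sum_{m\in\mathbb Z}m z^m$, these operator-valued currents satisfy, as formal series in $\zeta^{\pm1},\xi^{\pm1}$, $$[\beta(\zeta),\beta(\xi)]=\tfrac k2\bigl((D\delta)(\xi/\zeta)-(D\delta)(-\xi/\zeta)\bigr),$$ $$[\beta(\zeta),x(\xi)]=\bigl(\delta(\xi/\zeta)-\delta(-\xi/\zeta)\bigr)x(\xi),$$ $$[x(\zeta),x(\xi)]=-2\,\delta(-\xi/\zeta)\,\beta(\xi)+k\,(D\delta)(-\xi/\zeta).$$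 -/

import Mathlib

open scoped Nat

noncomputable section

namespace PrincipalAffine

/-- Complex `2 × 2` matrices. -/
abbrev Mat := Matrix (Fin 2) (Fin 2) ℂ

/-- Laurent polynomials in `t` with matrix coefficients; `single m a` is `a ⊗ t ^ m`. -/
abbrev Loop := LaurentPolynomial Mat

/-- The derivation `t d/dt` of the loop algebra. -/
def tdt : Loop →ₗ[ℂ] Loop :=
  (Finsupp.lsum ℂ fun m : ℤ => (m : ℂ) • AddMonoidAlgebra.lsingle (R := ℂ) (S := Mat) m) ∘ₗ
    (AddMonoidAlgebra.coeffLinearEquiv ℂ).toLinearMap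

/-- The linear functional `f = ∑ a_m ⊗ t ^ m ↦ tr a_0`. -/
def constTrace : Loop →ₗ[ℂ] ℂ :=
  (Matrix.traceLinearMap (Fin 2) ℂ ℂ) ∘ₗ (Finsupp.lapply (0 : ℤ)) ∘ₗ
    (AddMonoidAlgebra.coeffLinearEquiv ℂ).toLinearMap

lemma tdt_single (m : ℤ) (a : Mat) :
    tdt (AddMonoidAlgebra.single m a) = AddMonoidAlgebra.single m ((m : ℂ) • a) := by
  rw [← AddMonoidAlgebra.smul_single]
  change (Finsupp.lsum ℂ fun m : ℤ => (m : ℂ) • AddMonoidAlgebra.lsingle (R := ℂ) (S := Mat) m)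
    (Finsupp.single m a) = _
  rw [Finsupp.lsum_single]
  rfl

lemma constTrace_single (m : ℤ) (a : Mat) :
    constTrace (AddMonoidAlgebra.single m a) = if m = 0 then a.trace else 0 := by
  change Matrix.trace ((Finsupp.single m a) 0) = _
  by_cases h : m = 0 <;> simp [h]

lemma constTrace_tdt (f : Loop) : constTrace (tdt f) = 0 := by
  induction f using AddMonoidAlgebra.induction_linear with
  | zero => simp
  | add f g hf hg => simp [hf, hg]
  | single m a =>
    rw [tdt_single, constTrace_single]
    split_ifs with h <;> simp [h]

lemma tdt_mul (f g : Loop) : tdt (f * g) = tdt f * g + f * tdt g := by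
  induction f using AddMonoidAlgebra.induction_linear with
  | zero => simp
  | add f g hf hg => simp only [add_mul, map_add, hf, hg]; abel
  | single m a =>
    induction g using AddMonoidAlgebra.induction_linear with
    | zero => simp
    | add f g hf hg => simp only [mul_add, map_add, hf, hg]; abel
    | single n b =>
      simp only [AddMonoidAlgebra.single_mul_single, tdt_single, Matrix.smul_mul,
        Matrix.mul_smul, ← AddMonoidAlgebra.single_add, ← add_smul]
      push_cast
      rfl

lemma constTrace_mul_comm (f g : Loop) : constTrace (f * g) = constTrace (g * f) := by
  induction f using AddMonoidAlgebra.induction_linear with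
  | zero => simp
  | add f g hf hg => simp only [add_mul, mul_add, map_add, hf, hg]
  | single m a =>
    induction g using AddMonoidAlgebra.induction_linear with
    | zero => simp
    | add f g hf hg => simp only [add_mul, mul_add, map_add, hf, hg]
    | single n b =>
      simp only [AddMonoidAlgebra.single_mul_single, constTrace_single, add_comm n m,
        Matrix.trace_mul_comm a b]

/-- The vector space `𝔤𝔩₂ ⊗ ℂ[t, t⁻¹] ⊕ ℂ c ⊕ ℂ ρ`. -/
@[ext]
structure Ambient where
  /-- the component in `𝔤𝔩₂ ⊗ ℂ[t, t⁻¹]` -/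
  loop : Loop
  /-- the coefficient of the central element `c` -/
  cen : ℂ
  /-- the coefficient of the derivation element `ρ` -/
  der : ℂ

namespace Ambient

/-- The underlying triple. -/
def toProd : Ambient ≃ Loop × ℂ × ℂ where
  toFun x := (x.loop, x.cen, x.der)
  invFun y := ⟨y.1, y.2.1, y.2.2⟩
  left_inv _ := rfl
  right_inv _ := rfl

instance : AddCommGroup Ambient := toProd.addCommGroup
instance : Module ℂ Ambient := toProd.module ℂ

@[simp] lemma zero_loop : (0 : Ambient).loop = 0 := rfl
@[simp] lemma zero_cen : (0 : Ambient).cen = 0 := rfl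
@[simp] lemma zero_der : (0 : Ambient).der = 0 := rfl
@[simp] lemma add_loop (x y : Ambient) : (x + y).loop = x.loop + y.loop := rfl
@[simp] lemma add_cen (x y : Ambient) : (x + y).cen = x.cen + y.cen := rfl
@[simp] lemma add_der (x y : Ambient) : (x + y).der = x.der + y.der := rfl
@[simp] lemma smul_loop (r : ℂ) (x : Ambient) : (r • x).loop = r • x.loop := rfl
@[simp] lemma smul_cen (r : ℂ) (x : Ambient) : (r • x).cen = r * x.cen := rfl
@[simp] lemma smul_der (r : ℂ) (x : Ambient) : (r • x).der = r * x.der := rfl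

/-- The bracket of the affine Lie algebra: `c` is central, `[ρ, f] = t df/dt`, and
`[f, g] = f g - g f + (1/2) (tr ((t df/dt) g))_0 c`; on monomials the last formula reads
`[a ⊗ t ^ m, b ⊗ t ^ n] = [a, b] ⊗ t ^ (m + n) + (1/2) tr (a b) m δ_{m + n, 0} c`. -/
instance : Bracket Ambient Ambient where
  bracket x y :=
    { loop := x.loop * y.loop - y.loop * x.loop + x.der • tdt y.loop - y.der • tdt x.loop
      cen := (1 / 2) * constTrace (tdt x.loop * y.loop)
      der := 0 }

lemma lie_loop (x y : Ambient) : ⁅x, y⁆.loop =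
    x.loop * y.loop - y.loop * x.loop + x.der • tdt y.loop - y.der • tdt x.loop := rfl
lemma lie_cen (x y : Ambient) : ⁅x, y⁆.cen = (1 / 2) * constTrace (tdt x.loop * y.loop) := rfl
lemma lie_der (x y : Ambient) : ⁅x, y⁆.der = 0 := rfl

lemma constTrace_tdt_mul (f g : Loop) :
    constTrace (tdt f * g) = -constTrace (f * tdt g) := by
  have h := constTrace_tdt (f * g)
  rw [tdt_mul, map_add] at h
  linear_combination h

instance : LieRing Ambient where
  add_lie x y z := by
    ext1
    · simp only [lie_loop, add_loop, add_der, map_add, add_smul, smul_add, add_mul, mul_add]; abel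
    · simp only [lie_cen, add_loop, add_cen, map_add, add_mul]; ring
    · simp [lie_der]
  lie_add x y z := by
    ext1
    · simp only [lie_loop, add_loop, add_der, map_add, add_smul, smul_add, add_mul, mul_add]; abel
    · simp only [lie_cen, add_loop, add_cen, map_add, mul_add]
    · simp [lie_der]
  lie_self x := by
    ext1
    · simp [lie_loop]
    · have h := constTrace_tdt_mul x.loop x.loop
      rw [constTrace_mul_comm x.loop] at h
      simp only [lie_cen, zero_cen]
      linear_combination (1 / 4) * h
    · rfl
  leibniz_lie x y z := by
    ext1
    · simp only [lie_loop, lie_der, add_loop, zero_smul, map_add, map_sub, map_smul, tdt_mul,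
        mul_add, add_mul, mul_sub, sub_mul, smul_add, smul_sub, Algebra.mul_smul_comm,
        Algebra.smul_mul_assoc, mul_assoc, smul_smul, mul_comm y.der x.der, mul_comm z.der x.der,
        mul_comm z.der y.der]
      abel
    · have e (f g h : Loop) : constTrace (f * (g * h)) = constTrace (g * (h * f)) := by
        rw [constTrace_mul_comm, mul_assoc]
      simp only [lie_loop, lie_cen, add_cen, map_add, map_sub, map_smul, tdt_mul, add_mul, sub_mul,
        mul_add, mul_sub, Algebra.mul_smul_comm, Algebra.smul_mul_assoc, mul_assoc, smul_eq_mul]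
      have h1 := constTrace_tdt_mul (tdt x.loop) z.loop
      have h2 := constTrace_tdt_mul (tdt y.loop) z.loop
      have h3 := constTrace_mul_comm (tdt x.loop) (tdt y.loop)
      linear_combination (1 / 2) * e y.loop (tdt x.loop) z.loop -
        (1 / 2) * e x.loop (tdt y.loop) z.loop + (1 / 2) * y.der * h1 -
        (1 / 2) * x.der * h2 - (1 / 2) * z.der * h3
    · simp [lie_der]


instance : LieAlgebra ℂ Ambient where
  lie_smul r x y := by
    ext1
    · simp only [lie_loop, smul_loop, smul_der, map_smul, mul_smul_comm, smul_mul_assoc, smul_add,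
        smul_sub, smul_smul, mul_comm r]
    · simp only [lie_cen, smul_loop, smul_cen, map_smul, mul_smul_comm, smul_eq_mul]; ring
    · simp [lie_der]

end Ambient

/-- The standard generator `e` of `𝔰𝔩₂`. -/
def e : Mat := !![0, 1; 0, 0]

/-- The standard generator `f` of `𝔰𝔩₂`. -/
def f : Mat := !![0, 0; 1, 0]

/-- The standard generator `h` of `𝔰𝔩₂`. -/
def h : Mat := !![1, 0; 0, -1]

/-- The coefficients allowed at `t ^ m`: `𝔤₀ = ℂ h` for even `m`, `𝔤₁ = ℂ e ⊕ ℂ f` for odd `m`. -/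
def grade (m : ℤ) : Submodule ℂ Mat :=
  if Even m then Submodule.span ℂ {h} else Submodule.span ℂ {e, f}

lemma commutator_mem_grade {m n : ℤ} {a b : Mat} (ha : a ∈ grade m) (hb : b ∈ grade n) :
    a * b - b * a ∈ grade (m + n) := by
  unfold grade at *
  by_cases hm : Even m <;> by_cases hn : Even n <;>
    simp only [hm, hn, Int.even_add, if_true, if_false, iff_true, iff_false, not_true,
      Submodule.mem_span_singleton, Submodule.mem_span_pair] at ha hb ⊢
  · obtain ⟨x, rfl⟩ := ha
    obtain ⟨y, rfl⟩ := hb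
    exact ⟨0, by simp [smul_smul, mul_comm x y]⟩
  · obtain ⟨x, rfl⟩ := ha
    obtain ⟨y, z, rfl⟩ := hb
    refine ⟨2 * x * y, -2 * x * z, ?_⟩
    ext i j
    fin_cases i <;> fin_cases j <;> simp [e, f, h] <;> ring
  · obtain ⟨x, y, rfl⟩ := ha
    obtain ⟨z, rfl⟩ := hb
    refine ⟨-2 * x * z, 2 * y * z, ?_⟩
    ext i j
    fin_cases i <;> fin_cases j <;> simp [e, f, h] <;> ring
  · obtain ⟨x, y, rfl⟩ := ha
    obtain ⟨z, w, rfl⟩ := hb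
    refine ⟨x * w - y * z, ?_⟩
    ext i j
    fin_cases i <;> fin_cases j <;> simp [e, f, h] <;> ring

/-- The space `𝔤₀ ⊗ ℂ[t ^ 2, t ^ (-2)] ⊕ 𝔤₁ ⊗ t ℂ[t ^ 2, t ^ (-2)]`. -/
def principalLoop : Submodule ℂ Loop where
  carrier := {g | ∀ m, g.coeff m ∈ grade m}
  zero_mem' m := by simp
  add_mem' ha hb m := by simpa using add_mem (ha m) (hb m)
  smul_mem' r _ ha m := by simpa using Submodule.smul_mem _ r (ha m)

lemma single_mem_principalLoop {m : ℤ} {a : Mat} (ha : a ∈ grade m) :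
    AddMonoidAlgebra.single m a ∈ principalLoop := by
  intro n
  rw [AddMonoidAlgebra.coeff_single, Finsupp.single_apply]
  split_ifs with hmn
  · exact hmn ▸ ha
  · exact zero_mem _

lemma tdt_mem_principalLoop {g : Loop} (hg : g ∈ principalLoop) : tdt g ∈ principalLoop := by
  rw [← AddMonoidAlgebra.sum_coeff_single g, Finsupp.sum, map_sum]
  refine sum_mem fun m _ => ?_
  rw [tdt_single]
  exact single_mem_principalLoop (Submodule.smul_mem _ _ (hg m))

lemma commutator_mem_principalLoop {g k : Loop} (hg : g ∈ principalLoop)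
    (hk : k ∈ principalLoop) : g * k - k * g ∈ principalLoop := by
  rw [← AddMonoidAlgebra.sum_coeff_single g, ← AddMonoidAlgebra.sum_coeff_single k, Finsupp.sum,
    Finsupp.sum, Finset.sum_mul_sum, Finset.sum_mul_sum, Finset.sum_comm, ← Finset.sum_sub_distrib]
  refine sum_mem fun m _ => ?_
  rw [← Finset.sum_sub_distrib]
  refine sum_mem fun n _ => ?_
  rw [AddMonoidAlgebra.single_mul_single, AddMonoidAlgebra.single_mul_single, add_comm m n,
    ← AddMonoidAlgebra.single_sub]
  exact single_mem_principalLoop (commutator_mem_grade (hg n) (hk m))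

/-- The affine Lie algebra `𝔰𝔩₂^` in the principal picture:
`𝔤₀ ⊗ ℂ[t ^ 2, t ^ (-2)] ⊕ 𝔤₁ ⊗ t ℂ[t ^ 2, t ^ (-2)] ⊕ ℂ c ⊕ ℂ ρ`. -/
def affineSl2 : LieSubalgebra ℂ Ambient where
  carrier := {x | x.loop ∈ principalLoop}
  zero_mem' := zero_mem principalLoop
  add_mem' ha hb := principalLoop.add_mem ha hb
  smul_mem' r _ ha := principalLoop.smul_mem r ha
  lie_mem' {x y} hx hy := by
    change ⁅x, y⁆.loop ∈ principalLoop
    rw [Ambient.lie_loop]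
    exact sub_mem (add_mem (commutator_mem_principalLoop hx hy)
      (principalLoop.smul_mem _ (tdt_mem_principalLoop hy)))
      (principalLoop.smul_mem _ (tdt_mem_principalLoop hx))

/-- The element `a ⊗ t ^ m`. -/
def monom (m : ℤ) (a : Mat) (ha : a ∈ grade m) : affineSl2 :=
  ⟨⟨AddMonoidAlgebra.single m a, 0, 0⟩, by exact single_mem_principalLoop ha⟩

/-- The central element `c`. -/
def c : affineSl2 := ⟨⟨0, 1, 0⟩, by exact zero_mem principalLoop⟩

/-- The derivation element `ρ`. -/
def ρ : affineSl2 := ⟨⟨0, 0, 1⟩, by exact zero_mem principalLoop⟩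

/-- `[a ⊗ t ^ m, b ⊗ t ^ n] = [a, b] ⊗ t ^ (m + n) + (1/2) (a, b) m δ_{m + n, 0} c`, where
`(a, b) = tr (a b)` is the invariant form with `(e, f) = 1`, `(h, h) = 2`. -/
lemma lie_monom (m n : ℤ) (a b : Mat) (ha : a ∈ grade m) (hb : b ∈ grade n) :
    ⁅monom m a ha, monom n b hb⁆ =
      monom (m + n) (a * b - b * a) (commutator_mem_grade ha hb) +
        (if m + n = 0 then (1 / 2) * (a * b).trace * (m : ℂ) else 0) • c := by
  apply Subtype.ext
  change ⁅(⟨AddMonoidAlgebra.single m a, 0, 0⟩ : Ambient),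
    (⟨AddMonoidAlgebra.single n b, 0, 0⟩ : Ambient)⁆ =
    (⟨AddMonoidAlgebra.single (m + n) (a * b - b * a), 0, 0⟩ : Ambient) +
      (if m + n = 0 then (1 / 2) * (a * b).trace * (m : ℂ) else 0) • (⟨0, 1, 0⟩ : Ambient)
  ext1
  · simp only [Ambient.lie_loop, Ambient.add_loop, Ambient.smul_loop,
      AddMonoidAlgebra.single_mul_single, AddMonoidAlgebra.single_sub, add_comm n m, zero_smul,
      smul_zero, add_zero, sub_zero]
  · simp only [Ambient.lie_cen, Ambient.add_cen, Ambient.smul_cen, tdt_single,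
      AddMonoidAlgebra.single_mul_single, constTrace_single, Matrix.smul_mul, Matrix.trace_smul,
      smul_eq_mul]
    split_ifs <;> ring
  · simp only [Ambient.lie_der, Ambient.add_der, Ambient.smul_der, mul_zero, add_zero]

lemma lie_ρ_monom (m : ℤ) (a : Mat) (ha : a ∈ grade m) :
    ⁅ρ, monom m a ha⁆ = (m : ℂ) • monom m a ha := by
  apply Subtype.ext
  change ⁅(⟨0, 0, 1⟩ : Ambient), (⟨AddMonoidAlgebra.single m a, 0, 0⟩ : Ambient)⁆ =
    (m : ℂ) • (⟨AddMonoidAlgebra.single m a, 0, 0⟩ : Ambient)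
  ext1 <;> simp [Ambient.lie_loop, Ambient.lie_cen, Ambient.lie_der, -LaurentPolynomial.single_eq_C_mul_T, tdt_single, AddMonoidAlgebra.smul_single]

lemma lie_c (x : affineSl2) : ⁅c, x⁆ = 0 := by
  apply Subtype.ext
  change ⁅(⟨0, 1, 0⟩ : Ambient), x.1⁆ = 0
  ext1 <;> simp [Ambient.lie_loop, Ambient.lie_cen, Ambient.lie_der]

lemma e_add_f_mem {n : ℤ} (hn : Odd n) : e + f ∈ grade n := by
  rw [grade, if_neg (Int.not_even_iff_odd.mpr hn)]
  exact Submodule.mem_span_pair.mpr ⟨1, 1, by simp⟩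

lemma x_coeff_mem (n : ℤ) : (if Even n then h else -e + f) ∈ grade n := by
  unfold grade
  split_ifs
  · exact Submodule.mem_span_singleton_self h
  · exact Submodule.mem_span_pair.mpr ⟨-1, 1, by simp⟩

/-- `β_n = (e + f) ⊗ t ^ n` for odd `n`. -/
def βElt (n : ℤ) (hn : Odd n) : affineSl2 := monom n (e + f) (e_add_f_mem hn)

/-- `x_n = h ⊗ t ^ n` for even `n`, and `x_n = (-e + f) ⊗ t ^ n` for odd `n`. -/
def xElt (n : ℤ) : affineSl2 := monom n (if Even n then h else -e + f) (x_coeff_mem n)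

/-- Labels of the creation operators: `(i, n)` stands for `φ_{i,-n}`, where `n ≥ 1` is even for
`i = 1` and odd for `i = 0, 2`. -/
abbrev Osc := {p : Fin 3 × ℕ // 0 < p.2 ∧ (Even p.2 ↔ p.1 = 1)}

/-- The Fock space `F_{j,k} = ℂ[φ_{0,-n}, φ_{2,-n} (n odd), φ_{1,-n} (n even)] |j,k⟩`; the
polynomial `P` stands for `P |j,k⟩`. The numbers `j`, `k` enter through the action of the modes. -/
abbrev Fock := MvPolynomial Osc ℂ

/-- Linear operators on the Fock space. -/
abbrev Op := Module.End ℂ Fock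

/-- `[φ_{i,m}, φ_{i,n}] = bosonNorm k i * m * δ_{m + n, 0}`. -/
def bosonNorm (k : ℂ) (i : Fin 3) : ℂ := ![4 * k, 4 * (k + 2), -(4 * k)] i

/-- The mode `φ_{i,n}` acting on `F_{j,k}`: for `n < 0` it multiplies by the corresponding
variable, for `n > 0` it is `bosonNorm k i * n` times the derivative with respect to
`φ_{i,-n}`, and `φ_{1,0}` is `2 j`. Modes of the parity which does not occur in `φ_i` are `0`. -/
def mode (j k : ℂ) (i : Fin 3) (n : ℤ) : Op :=
  if hn : 0 < n.natAbs ∧ (Even n.natAbs ↔ i = 1) then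
    if n < 0 then LinearMap.mulLeft ℂ (MvPolynomial.X ⟨(i, n.natAbs), hn⟩)
    else (bosonNorm k i * n) • (MvPolynomial.pderiv (⟨(i, n.natAbs), hn⟩ : Osc)).toLinearMap
  else if n = 0 ∧ i = 1 then (2 * j) • 1 else 0

/-- The weight operator, the derivation with `φ_{i,-n} ↦ n φ_{i,-n}`. -/
def weightOp : Op :=
  (MvPolynomial.mkDerivation ℂ fun o : Osc => (o.1.2 : ℂ) • (MvPolynomial.X o : Fock)).toLinearMap

/-- The grading operator `d` on `F_{j,k}`: `d |j,k⟩ = (2 j ^ 2 + k) / (4 (k + 2)) |j,k⟩` and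
`[d, φ_{i,n}] = -n φ_{i,n}`. -/
def gradingOp (j k : ℂ) : Op := ((2 * j ^ 2 + k) / (4 * (k + 2))) • 1 + weightOp

/-- For `n ≠ 0`, the coefficient `-φ_{i,n} / n` of `ζ ^ (-n)` in the field `φ_i(ζ)`. -/
def fieldCoeff (j k : ℂ) (i : Fin 3) (n : ℤ) : Op := (-(1 / (n : ℂ))) • mode j k i n

/-- The coefficient of `ζ ^ (-n)` in `(D φ_i)(ζ)`, where `D = ζ d/dζ`: since
`D (-φ_{i,n} ζ ^ (-n) / n) = φ_{i,n} ζ ^ (-n)`, `D log ζ = 1` and `D Q = 0`, it is `φ_{i,n}`. -/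
def DField (j k : ℂ) (i : Fin 3) (n : ℤ) : Op := mode j k i n

/-- The exponential `∑_r u ^ r / r!` of a power series `u` with zero constant coefficient. The
coefficient of degree `n` only involves the terms with `r ≤ n`. -/
def expSeries (u : PowerSeries Op) : PowerSeries Op :=
  PowerSeries.mk fun n => ∑ r ∈ Finset.range (n + 1), ((r ! : ℂ)⁻¹) • PowerSeries.coeff n (u ^ r)

/-- The creation part (negative modes) of `(φ₂(ζ) + φ₀(ζ)) / k`, a power series in `ζ`. -/
def creationPart (j k : ℂ) : PowerSeries Op :=
  PowerSeries.mk fun p => if p = 0 then 0 else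
    (1 / k) • (fieldCoeff j k 2 (-(p : ℤ)) + fieldCoeff j k 0 (-(p : ℤ)))

/-- The annihilation part (positive modes) of `(φ₂(ζ) + φ₀(ζ)) / k`, a power series in `ζ⁻¹`. -/
def annihilationPart (j k : ℂ) : PowerSeries Op :=
  PowerSeries.mk fun q => if q = 0 then 0 else
    (1 / k) • (fieldCoeff j k 2 (q : ℤ) + fieldCoeff j k 0 (q : ℤ))

/-- The contributions to the coefficient of `ζ ^ (-N)` in
`:(D φ₁(ζ) + D φ₂(ζ)) exp (φ₂(ζ) / k + φ₀(ζ) / k):`. The exponential of the creation part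
contributes the term `E⁻` of degree `ζ ^ p`, that of the annihilation part the term `E⁺` of degree
`ζ ^ (-q)`, and `D φ₁ + D φ₂` its mode `A_m` with `m = N + p - q`. Normal ordering puts annihilation
operators (`m > 0`) to the right and all others to the left. -/
def currentTerm (j k : ℂ) (N : ℤ) (pq : ℕ × ℕ) : Op :=
  let m : ℤ := N + pq.1 - pq.2
  let A : Op := DField j k 1 m + DField j k 2 m
  let E : Op := PowerSeries.coeff pq.1 (expSeries (creationPart j k)) *
    PowerSeries.coeff pq.2 (expSeries (annihilationPart j k))
  if 0 < m then E * A else A * E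

/-- The vectors all of whose monomials have weight at most `D`. -/
def weightLE (D : ℤ) : Submodule ℂ Fock where
  carrier := {v | ∀ s ∈ v.support, ((Finsupp.weight (fun o : Osc => o.1.2) s : ℕ) : ℤ) ≤ D}
  zero_mem' := by simp
  add_mem' {a b} ha hb s hs := by
    classical
    rcases Finset.mem_union.mp (MvPolynomial.support_add hs) with h | h
    exacts [ha s h, hb s h]
  smul_mem' r a ha s hs := ha s (MvPolynomial.support_smul hs)

/-- The operators lowering the weight by at least `n`. -/
def lowering (n : ℤ) : Submodule ℂ Op where
  carrier := {T | ∀ D, ∀ v ∈ weightLE D, T v ∈ weightLE (D - n)}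
  zero_mem' _ _ _ := zero_mem _
  add_mem' ha hb D v hv := add_mem (ha D v hv) (hb D v hv)
  smul_mem' r _ ha D v hv := Submodule.smul_mem _ r (ha D v hv)

lemma weightLE_eq_zero {D : ℤ} (hD : D < 0) {v : Fock} (hv : v ∈ weightLE D) : v = 0 := by
  rw [← MvPolynomial.support_eq_empty, Finset.eq_empty_iff_forall_notMem]
  intro s hs
  have := hv s hs
  omega

lemma exists_mem_weightLE (v : Fock) : ∃ D, v ∈ weightLE D := by
  refine ⟨((v.support.sup fun s => Finsupp.weight (fun o : Osc => o.1.2) s : ℕ) : ℤ), ?_⟩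
  intro s hs
  exact_mod_cast Finset.le_sup (f := fun s => Finsupp.weight (fun o : Osc => o.1.2) s) hs

lemma mul_mem_lowering {m n : ℤ} {S T : Op} (hS : S ∈ lowering m) (hT : T ∈ lowering n) :
    S * T ∈ lowering (m + n) := by
  intro D v hv
  have := hS _ _ (hT D v hv)
  rwa [sub_sub, add_comm n m] at this

lemma one_mem_lowering : (1 : Op) ∈ lowering 0 := by
  intro D v hv
  simpa using hv

lemma mode_mem_lowering (j k : ℂ) (i : Fin 3) (n : ℤ) : mode j k i n ∈ lowering n := by
  unfold mode
  split_ifs with hn h0 h1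
  · intro D v hv s hs
    classical
    rw [LinearMap.mulLeft_apply, MvPolynomial.support_X_mul, Finset.mem_map] at hs
    obtain ⟨u, hu, rfl⟩ := hs
    have := hv u hu
    simp only [addLeftEmbedding_apply, map_add, Finsupp.weight_single, one_smul]
    push_cast
    rw [abs_of_neg h0]
    omega
  · refine Submodule.smul_mem _ _ ?_
    intro D v hv
    rw [← MvPolynomial.support_sum_monomial_coeff v, map_sum]
    refine sum_mem fun u hu s hs => ?_
    have hw := hv u hu
    change s ∈ (MvPolynomial.pderiv _ (MvPolynomial.monomial u _)).support at hs
    rw [MvPolynomial.pderiv_monomial] at hs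
    obtain rfl := Finset.mem_singleton.mp (MvPolynomial.support_monomial_subset hs)
    have hui : u ⟨(i, n.natAbs), hn⟩ ≠ 0 := by
      intro h
      simp [h] at hs
    rw [← tsub_add_cancel_of_le (Finsupp.single_le_iff.mpr (Nat.one_le_iff_ne_zero.mpr hui)),
      map_add, Finsupp.weight_single, one_smul] at hw
    push_cast at hw
    rw [abs_of_nonneg (not_lt.mp h0)] at hw
    linarith
  · rw [h1.1]
    exact Submodule.smul_mem _ _ one_mem_lowering
  · exact zero_mem _

lemma coeff_pow_mem_lowering (ε : ℤ) (u : PowerSeries Op)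
    (hu : ∀ n : ℕ, PowerSeries.coeff n u ∈ lowering (ε * n)) (r n : ℕ) :
    PowerSeries.coeff n (u ^ r) ∈ lowering (ε * n) := by
  induction r generalizing n with
  | zero =>
    rw [pow_zero, PowerSeries.coeff_one]
    split_ifs with h
    · simpa [h] using one_mem_lowering
    · exact zero_mem _
  | succ r ih =>
    rw [pow_succ, PowerSeries.coeff_mul]
    refine sum_mem fun pq hpq => ?_
    have := mul_mem_lowering (ih pq.1) (hu pq.2)
    rwa [← mul_add, ← Nat.cast_add, Finset.HasAntidiagonal.mem_antidiagonal.mp hpq] at this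

lemma expSeries_mem_lowering (ε : ℤ) (u : PowerSeries Op)
    (hu : ∀ n : ℕ, PowerSeries.coeff n u ∈ lowering (ε * n)) (n : ℕ) :
    PowerSeries.coeff n (expSeries u) ∈ lowering (ε * n) := by
  rw [expSeries, PowerSeries.coeff_mk]
  exact sum_mem fun r _ => Submodule.smul_mem _ _ (coeff_pow_mem_lowering ε u hu r n)

lemma creation_mem_lowering (j k : ℂ) (n : ℕ) :
    PowerSeries.coeff n (expSeries (creationPart j k)) ∈ lowering (-n) := by
  rw [← neg_one_mul]
  refine expSeries_mem_lowering _ _ (fun n => ?_) n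
  rw [creationPart, PowerSeries.coeff_mk, neg_one_mul]
  split_ifs
  · exact zero_mem _
  · exact Submodule.smul_mem _ _ (add_mem (Submodule.smul_mem _ _ (mode_mem_lowering _ _ _ _))
      (Submodule.smul_mem _ _ (mode_mem_lowering _ _ _ _)))

lemma annihilation_mem_lowering (j k : ℂ) (n : ℕ) :
    PowerSeries.coeff n (expSeries (annihilationPart j k)) ∈ lowering n := by
  rw [← one_mul (n : ℤ)]
  refine expSeries_mem_lowering _ _ (fun n => ?_) n
  rw [annihilationPart, PowerSeries.coeff_mk, one_mul]
  split_ifs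
  · exact zero_mem _
  · exact Submodule.smul_mem _ _ (add_mem (Submodule.smul_mem _ _ (mode_mem_lowering _ _ _ _))
      (Submodule.smul_mem _ _ (mode_mem_lowering _ _ _ _)))

/-- On each vector only finitely many of the contributions are nonzero. -/
lemma currentTerm_finite (j k : ℂ) (N : ℤ) (v : Fock) :
    {pq | currentTerm j k N pq v ≠ 0}.Finite := by
  obtain ⟨D, hv⟩ := exists_mem_weightLE v
  refine ((Set.finite_Iic (D.natAbs + N.natAbs)).prod
    (Set.finite_Iic (D.natAbs + N.natAbs))).subset ?_
  rintro ⟨p, q⟩ hpq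
  by_contra hlt
  apply hpq
  have hA : DField j k 1 (N + p - q) + DField j k 2 (N + p - q) ∈ lowering (N + p - q) :=
    add_mem (mode_mem_lowering _ _ _ _) (mode_mem_lowering _ _ _ _)
  have hC := creation_mem_lowering j k p
  have hE := annihilation_mem_lowering j k q
  simp only [Set.mem_prod, Set.mem_Iic, not_and_or, not_le] at hlt
  simp only [currentTerm]
  split_ifs with hm
  · have := weightLE_eq_zero (by omega) (hE _ _ (hA D v hv))
    rw [Module.End.mul_apply, Module.End.mul_apply, this, map_zero]
  · have := weightLE_eq_zero (by omega) (hE D v hv)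
    rw [Module.End.mul_apply, Module.End.mul_apply, this, map_zero, map_zero]

/-- The sum of a locally finite family of operators. -/
def locSum {ι : Type*} (T : ι → Op) (hT : ∀ v, {i | T i v ≠ 0}.Finite) : Op where
  toFun v := ∑ᶠ i, T i v
  map_add' v w := by
    simp only [map_add]
    exact finsum_add_distrib (hT v) (hT w)
  map_smul' r v := by
    simp only [map_smul, RingHom.id_apply]
    exact (smul_finsum' r (hT v)).symm

/-- The coefficient `β_n` of `ζ ^ (-n)` in `β(ζ) = (1/2) D φ₀(ζ)`. -/
def βOp (j k : ℂ) (n : ℤ) : Op := (1 / 2 : ℂ) • DField j k 0 n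

/-- The coefficient `x_n` of `ζ ^ (-n)` in
`x(ζ) = (1/2) :(D φ₁(ζ) + D φ₂(ζ)) exp (φ₂(ζ) / k + φ₀(ζ) / k):`. -/
def xOp (j k : ℂ) (n : ℤ) : Op :=
  (1 / 2 : ℂ) • locSum (currentTerm j k n) (currentTerm_finite j k n)

lemma mode_one_zero (j k : ℂ) : mode j k 1 0 = (2 * j) • 1 := by
  simp [mode]

lemma mode_vacuum (j k : ℂ) (i : Fin 3) {n : ℤ} (hn : 0 < n) : mode j k i n 1 = 0 := by
  unfold mode
  split_ifs with h h0 h1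
  · omega
  · simp
  · omega
  · rfl

lemma gradingOp_vacuum (j k : ℂ) :
    gradingOp j k 1 = ((2 * j ^ 2 + k) / (4 * (k + 2))) • (1 : Fock) := by
  simp [gradingOp, weightOp]

lemma pderiv_comm (a b : Osc) (v : Fock) :
    MvPolynomial.pderiv a (MvPolynomial.pderiv b v) =
      MvPolynomial.pderiv b (MvPolynomial.pderiv a v) := by
  classical
  have h : ⁅(MvPolynomial.pderiv a : Derivation ℂ Fock Fock),
      (MvPolynomial.pderiv b : Derivation ℂ Fock Fock)⁆ = 0 := by
    refine MvPolynomial.derivation_ext fun o => ?_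
    rw [Derivation.commutator_apply]
    simp only [MvPolynomial.pderiv_X, Pi.single_apply]
    split_ifs <;> simp
  have := congrArg (fun d : Derivation ℂ Fock Fock => d v) h
  simpa [Derivation.commutator_apply, sub_eq_zero] using this

/-- The Heisenberg relations `[φ_{i,m}, φ_{i',n}] = δ_{i,i'} bosonNorm k i m δ_{m + n, 0}`. -/
lemma lie_mode (j k : ℂ) (i i' : Fin 3) (m n : ℤ) (hm : Even m ↔ i = 1) (hn : Even n ↔ i' = 1) :
    ⁅mode j k i m, mode j k i' n⁆ =
      if i = i' ∧ m + n = 0 then (bosonNorm k i * m) • (1 : Op) else 0 := by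
  classical
  have hz (l : ℤ) (q : Fin 3) (hl : Even l ↔ q = 1) :
      (0 < l.natAbs ∧ (Even l.natAbs ↔ q = 1)) ↔ l ≠ 0 := by
    rw [Int.natAbs_even, Int.natAbs_pos]
    exact and_iff_left hl
  have hzero (l : ℤ) (q : Fin 3) (hl : Even l ↔ q = 1) (h0 : l = 0) :
      mode j k q l = (2 * j) • 1 := by
    subst h0
    obtain rfl := hl.mp Even.zero
    exact mode_one_zero j k
  by_cases hm0 : m = 0
  · rw [hzero m i hm hm0]
    subst hm0
    simp [Ring.lie_def]
  by_cases hn0 : n = 0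
  · rw [hzero n i' hn hn0]
    subst hn0
    simp [Ring.lie_def, hm0]
  refine LinearMap.ext fun v => ?_
  rw [Ring.lie_def, LinearMap.sub_apply, Module.End.mul_apply, Module.End.mul_apply]
  simp only [mode, dif_pos ((hz m i hm).mpr hm0), dif_pos ((hz n i' hn).mpr hn0)]
  by_cases h1 : m < 0 <;> by_cases h2 : n < 0 <;> simp only [h1, h2, if_true, if_false]
  · rw [if_neg (by omega)]
    simp [mul_left_comm]
  · simp only [LinearMap.mulLeft_apply, LinearMap.smul_apply, Derivation.coeFn_coe,
      Derivation.leibniz, MvPolynomial.pderiv_X, Pi.single_apply]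
    by_cases hc : i = i' ∧ m + n = 0
    · have hs : m.natAbs = n.natAbs := by omega
      obtain ⟨rfl, hmn⟩ := hc
      have hn' : (n : ℂ) = -m := by rw [← Int.cast_neg, show n = -m by omega]
      simp [hmn, hs, hn', smul_add]
    · have hs : ¬(i = i' ∧ m.natAbs = n.natAbs) := by omega
      simp [hc, hs]
  · simp only [LinearMap.mulLeft_apply, LinearMap.smul_apply, Derivation.coeFn_coe,
      Derivation.leibniz, MvPolynomial.pderiv_X, Pi.single_apply]
    by_cases hc : i = i' ∧ m + n = 0
    · have hs : m.natAbs = n.natAbs := by omega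
      obtain ⟨rfl, hmn⟩ := hc
      simp [hmn, hs, smul_add]
    · have hs : ¬(i' = i ∧ n.natAbs = m.natAbs) := by omega
      simp [hc, hs]
  · rw [if_neg (by omega)]
    simp [pderiv_comm, smul_smul, mul_comm]

lemma weight_pderiv (a : Osc) (v : Fock) :
    MvPolynomial.mkDerivation ℂ (fun o : Osc => (o.1.2 : ℂ) • (MvPolynomial.X o : Fock))
        (MvPolynomial.pderiv a v) -
      MvPolynomial.pderiv a (MvPolynomial.mkDerivation ℂ
        (fun o : Osc => (o.1.2 : ℂ) • (MvPolynomial.X o : Fock)) v) =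
      (-(a.1.2 : ℂ)) • MvPolynomial.pderiv a v := by
  classical
  have h : ⁅MvPolynomial.mkDerivation ℂ (fun o : Osc => (o.1.2 : ℂ) • (MvPolynomial.X o : Fock)),
      (MvPolynomial.pderiv a : Derivation ℂ Fock Fock)⁆ =
      (-(a.1.2 : ℂ)) • (MvPolynomial.pderiv a : Derivation ℂ Fock Fock) := by
    refine MvPolynomial.derivation_ext fun o => ?_
    rw [Derivation.commutator_apply, Derivation.smul_apply, MvPolynomial.mkDerivation_X,
      Derivation.map_smul]
    simp only [MvPolynomial.pderiv_X, Pi.single_apply]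
    split_ifs with ho
    · simp [ho]
    · simp
  have := congrArg (fun d : Derivation ℂ Fock Fock => d v) h
  simpa [Derivation.commutator_apply] using this

/-- The relation `[d, φ_{i,n}] = -n φ_{i,n}`. -/
lemma lie_gradingOp_mode (j k : ℂ) (i : Fin 3) (n : ℤ) :
    ⁅gradingOp j k, mode j k i n⁆ = (-(n : ℂ)) • mode j k i n := by
  have h0 : ⁅gradingOp j k, mode j k i n⁆ = ⁅weightOp, mode j k i n⁆ := by
    simp [gradingOp, Ring.lie_def, add_mul, mul_add]
  rw [h0]
  refine LinearMap.ext fun v => ?_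
  rw [Ring.lie_def, LinearMap.sub_apply, Module.End.mul_apply, Module.End.mul_apply, mode]
  split_ifs with h h1 h2
  · simp only [weightOp, LinearMap.mulLeft_apply, LinearMap.smul_apply, Derivation.coeFn_coe,
      Derivation.leibniz, MvPolynomial.mkDerivation_X]
    have hn' : ((n.natAbs : ℕ) : ℂ) = -n := by
      rw [← Int.cast_neg, ← Int.cast_natCast, Int.ofNat_natAbs_of_nonpos h1.le]
    simp [hn', mul_comm]
  · simp only [weightOp, LinearMap.smul_apply, Derivation.coeFn_coe, map_smul]
    have hn' : ((n.natAbs : ℕ) : ℂ) = n := by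
      rw [← Int.cast_natCast, Int.natAbs_of_nonneg (not_lt.mp h1)]
    have := weight_pderiv ⟨(i, n.natAbs), h⟩ v
    rw [← smul_sub, this, hn', smul_comm]
  · simp [h2.1]
  · simp

/-- The coefficient of `ζ ^ (-m) ξ ^ (-n)` in `δ(ε ξ / ζ)`, where `δ(z) = ∑_{r ∈ ℤ} z ^ r`. -/
def delta (ε : ℂ) (m n : ℤ) : ℂ := if m + n = 0 then ε ^ m else 0

/-- The coefficient of `ζ ^ (-m) ξ ^ (-n)` in `(D δ)(ε ξ / ζ)`, where
`(D δ)(z) = ∑_{r ∈ ℤ} r z ^ r`. -/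
def Ddelta (ε : ℂ) (m n : ℤ) : ℂ := if m + n = 0 then (m : ℂ) * ε ^ m else 0

/-- The coefficient of `ζ ^ (-m) ξ ^ (-n)` in `K(ζ, ξ) b(ξ)`, where `K(ζ, ξ)` is a scalar series
with coefficients `K m l` and `b(ξ) = ∑ b_n ξ ^ (-n)`. It is used only where the sum is finite. -/
def mulRight (K : ℤ → ℤ → ℂ) (b : ℤ → Op) (m n : ℤ) : Op := ∑ᶠ l : ℤ, K m l • b (n - l)

/-- The coefficient of `ζ ^ (-m) ξ ^ (-n)` in `[a(ζ), b(ξ)]`. -/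
def lieSeries (a b : ℤ → Op) (m n : ℤ) : Op := ⁅a m, b n⁆

/-- `[β(ζ), β(ξ)] = (c / 2) ((D δ)(ξ / ζ) - (D δ)(-ξ / ζ))`. -/
def RelationBB (β : ℤ → Op) (c : ℂ) : Prop :=
  ∀ m n, lieSeries β β m n = ((c / 2) * (Ddelta 1 m n - Ddelta (-1) m n)) • (1 : Op)

/-- `[β(ζ), x(ξ)] = (δ(ξ / ζ) - δ(-ξ / ζ)) x(ξ)`. -/
def RelationBX (β x : ℤ → Op) : Prop :=
  ∀ m n, lieSeries β x m n = mulRight (fun m l => delta 1 m l - delta (-1) m l) x m n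

/-- `[x(ζ), x(ξ)] = -2 δ(-ξ / ζ) β(ξ) + c (D δ)(-ξ / ζ)`. -/
def RelationXX (β x : ℤ → Op) (c : ℂ) : Prop :=
  ∀ m n, lieSeries x x m n =
    (-2 : ℂ) • mulRight (delta (-1)) β m n + (c * Ddelta (-1) m n) • (1 : Op)

end PrincipalAffine

end

attribute [local instance] LieRing.ofAssociativeRing

noncomputable section

namespace PrincipalAffine

/-! ### The finite topology on the operators of the Fock space -/

/-! Put φ = (φ₂ + φ₀)/k, V(ζ) = exp φ(ζ) normally ordered, A = Dφ₁ + Dφ₂ and J = :A V:, so that x =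
J/2. The norms of φ₀ and φ₂ are opposite, so the modes of φ commute with one another. Hence the
modes of V commute, and V has charges 4, 0, -4 under the odd modes of φ₀, φ₁, φ₂ (`lie_mode_vertex`,
`lie_vertex_vertex`). As φ is odd in ζ, V(ζ)V(-ζ) = 1 (`tsum_neg_one_pow_vertex_mul`); this is the
source of δ(-ξ/ζ).

The relations involving β follow from the Heisenberg relations and `lie_mode_current`. For [x, x],
let `defect` be the difference of the two sides, scaled to J = 2x. The bracket of a mode with a
defect is a combination of defects (`lie_mode_defect`); the input beyond the Jacobi identity is
`lie_vertex_current_sub`, which rests on V(ζ)V(-ζ) = 1. Since the vacuum is cyclic, the defects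
vanish as soon as they kill the vacuum (`eq_zero_of_lie_mode`). In nonzero weight their values on
the vacuum vanish by induction on the weight: such a value is killed by every annihilation mode, and
for k ≠ 0, -2 only multiples of the vacuum are (`defect_apply_one`). In weight zero one computes J_M
J_{-M}|j,k⟩ (`current_current_apply_one`); there the 2 in the norm 4(k + 2) of φ₁ is cancelled by a
contribution of the odd modes.

Finally β_n, x_n, c, ρ span the affine algebra (`span_generators`), which gives uniqueness and
reduces existence to brackets of these elements. Infinite sums of modes are convergent sums in the
finite topology: the filtration `lowering` supplies convergence, the grading `graded` exact degrees.
-/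

/-- The topology of pointwise convergence, for the discrete topology on the Fock space. -/
@[reducible]
def opTopology : TopologicalSpace Op :=
  TopologicalSpace.induced (fun T : Op => (T : Fock → Fock))
    (@Pi.topologicalSpace Fock (fun _ => Fock) fun _ => ⊥)

attribute [local instance] opTopology

/-- Convergence is eventual equality on each single vector, so every topological statement below
reduces to finite sums applied to one vector. -/
lemma tendsto_op_iff {α : Type*} {l : Filter α} {F : α → Op} {T : Op} :
    Filter.Tendsto F l (nhds T) ↔ ∀ v, ∀ᶠ a in l, F a v = T v := by
  let _ : TopologicalSpace Fock := ⊥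
  have : DiscreteTopology Fock := ⟨rfl⟩
  rw [nhds_induced, Filter.tendsto_comap_iff, tendsto_pi_nhds]
  simp [nhds_discrete, Filter.tendsto_pure]

lemma eventually_apply_eq (T : Op) (v : Fock) : ∀ᶠ S in nhds T, S v = T v :=
  tendsto_op_iff.mp (Filter.tendsto_id (x := nhds T)) v

instance : T2Space Op := by
  let _ : TopologicalSpace Fock := ⊥
  have : DiscreteTopology Fock := ⟨rfl⟩
  exact T2Space.of_injective_continuous (f := fun T : Op => (T : Fock → Fock))
    DFunLike.coe_injective continuous_induced_dom

instance : IsTopologicalRing Op where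
  continuous_add := by
    rw [continuous_iff_continuousAt]
    rintro ⟨S, T⟩
    refine tendsto_op_iff.mpr fun v => ?_
    rw [nhds_prod_eq]
    filter_upwards [(eventually_apply_eq S v).prod_mk (eventually_apply_eq T v)] with p hp
    rw [LinearMap.add_apply, LinearMap.add_apply, hp.1, hp.2]
  continuous_mul := by
    rw [continuous_iff_continuousAt]
    rintro ⟨S, T⟩
    refine tendsto_op_iff.mpr fun v => ?_
    rw [nhds_prod_eq]
    filter_upwards [(eventually_apply_eq S (T v)).prod_mk (eventually_apply_eq T v)] with p hp
    rw [Module.End.mul_apply, Module.End.mul_apply, hp.2, hp.1]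
  continuous_neg := by
    rw [continuous_iff_continuousAt]
    intro T
    refine tendsto_op_iff.mpr fun v => ?_
    filter_upwards [eventually_apply_eq T v] with S hS
    rw [LinearMap.neg_apply, LinearMap.neg_apply, hS]

instance : ContinuousConstSMul ℂ Op where
  continuous_const_smul r := by
    simpa only [Algebra.smul_def] using continuous_const_mul (algebraMap ℂ Op r)

lemma hasSum_locSum {ι : Type*} (T : ι → Op) (hT : ∀ v, {i | T i v ≠ 0}.Finite) :
    HasSum T (locSum T hT) := by
  refine tendsto_op_iff.mpr fun v => ?_
  filter_upwards [Filter.eventually_ge_atTop (hT v).toFinset] with s hs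
  rw [LinearMap.sum_apply]
  exact (finsum_eq_sum_of_support_subset _ fun i hi => hs ((hT v).mem_toFinset.mpr hi)).symm

/-- Every vector lies in some `weightLE D`, so finiteness uniform on these subspaces is local
finiteness. -/
lemma summable_of_weightLE {ι : Type*} {T : ι → Op}
    (hT : ∀ D : ℤ, ∃ s : Set ι, s.Finite ∧ ∀ i ∉ s, ∀ v ∈ weightLE D, T i v = 0) :
    Summable T := by
  refine ⟨_, hasSum_locSum T fun v => ?_⟩
  obtain ⟨D, hv⟩ := exists_mem_weightLE v
  obtain ⟨s, hs, h⟩ := hT D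
  exact hs.subset fun i hi => by_contra fun his => hi (h i his v hv)

lemma tsum_apply_eq_sum {ι : Type*} {T : ι → Op} (hT : Summable T) (v : Fock) :
    ∃ s : Finset ι, ∀ t, s ⊆ t → (∑' i, T i) v = ∑ i ∈ t, T i v := by
  obtain ⟨s, hs⟩ := Filter.eventually_atTop.mp (tendsto_op_iff.mp hT.hasSum v)
  refine ⟨s, fun t ht => ?_⟩
  rw [← LinearMap.sum_apply, hs t ht]

lemma tsum_apply_eq_sum_of_eq_zero {ι : Type*} {T : ι → Op} (hT : Summable T) {v : Fock}
    (s : Finset ι) (hs : ∀ i ∉ s, T i v = 0) : (∑' i, T i) v = ∑ i ∈ s, T i v := by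
  classical
  obtain ⟨t, ht⟩ := tsum_apply_eq_sum hT v
  rw [ht (s ∪ t) Finset.subset_union_right]
  exact (Finset.sum_subset Finset.subset_union_left fun i _ hi => hs i hi).symm

lemma tsum_apply_mem {ι : Type*} {T : ι → Op} (hT : Summable T) {v : Fock} {W : Submodule ℂ Fock}
    (hW : ∀ i, T i v ∈ W) : (∑' i, T i) v ∈ W := by
  obtain ⟨s, hs⟩ := tsum_apply_eq_sum hT v
  rw [hs s subset_rfl]
  exact sum_mem fun i _ => hW i

lemma tsum_mem_lowering {ι : Type*} {T : ι → Op} (hT : Summable T) {n : ℤ}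
    (h : ∀ i, T i ∈ lowering n) : ∑' i, T i ∈ lowering n :=
  fun D v hv => tsum_apply_mem hT fun i => h i D v hv

lemma hasSum_lie {ι : Type*} {F : ι → Op} {a : Op} (hF : HasSum F a) (T : Op) :
    HasSum (fun i => ⁅T, F i⁆) ⁅T, a⁆ := by
  simp only [LieRing.of_associative_ring_bracket]
  exact (hF.mul_left T).sub (hF.mul_right T)

lemma lie_tsum {ι : Type*} {F : ι → Op} (hF : Summable F) (T : Op) :
    ⁅T, ∑' i, F i⁆ = ∑' i, ⁅T, F i⁆ :=
  (hasSum_lie hF.hasSum T).tsum_eq.symm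

/-! ### Gradings and kernels of the annihilation operators -/

/-- The operators homogeneous of degree `-n` for the grading operator. -/
def graded (n : ℤ) : Submodule ℂ Op where
  carrier := {T | ⁅weightOp, T⁆ = (-(n : ℂ)) • T}
  zero_mem' := by simp
  add_mem' {a b} ha hb := by
    simp only [Set.mem_ofPred_eq, lie_add, smul_add] at *
    rw [ha, hb]
  smul_mem' r a ha := by
    simp only [Set.mem_ofPred_eq] at *
    rw [lie_smul, ha, smul_comm]

lemma mem_graded {n : ℤ} {T : Op} : T ∈ graded n ↔ ⁅weightOp, T⁆ = (-(n : ℂ)) • T := Iff.rfl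

lemma lie_mul (T S R : Op) : ⁅T, S * R⁆ = ⁅T, S⁆ * R + S * ⁅T, R⁆ := by
  simp only [LieRing.of_associative_ring_bracket, sub_mul, mul_sub, mul_assoc]
  abel

lemma op_neg_smul (r : ℂ) (T : Op) : (-r) • T = -(r • T) := neg_smul r T

lemma op_sub_smul (r s : ℂ) (T : Op) : (r - s) • T = r • T - s • T := sub_smul r s T

lemma op_smul_sub (r : ℂ) (S T : Op) : r • (S - T) = r • S - r • T := smul_sub r S T

lemma op_lie_smul (T S : Op) (r : ℂ) : ⁅T, r • S⁆ = r • ⁅T, S⁆ := by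
  simp only [LieRing.of_associative_ring_bracket, mul_smul_comm, smul_mul_assoc, smul_sub]

lemma op_smul_lie (T S : Op) (r : ℂ) : ⁅r • T, S⁆ = r • ⁅T, S⁆ := by
  simp only [LieRing.of_associative_ring_bracket, mul_smul_comm, smul_mul_assoc, smul_sub]

lemma mul_mem_graded {m n : ℤ} {S T : Op} (hS : S ∈ graded m) (hT : T ∈ graded n) :
    S * T ∈ graded (m + n) := by
  rw [mem_graded] at *
  rw [lie_mul, hS, hT, smul_mul_assoc, mul_smul_comm, ← add_smul]
  push_cast
  congr 1
  ring

lemma one_mem_graded : (1 : Op) ∈ graded 0 := by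
  rw [mem_graded, LieRing.of_associative_ring_bracket]
  simp

lemma lie_mem_graded {m n : ℤ} {S T : Op} (hS : S ∈ graded m) (hT : T ∈ graded n) :
    ⁅S, T⁆ ∈ graded (m + n) := by
  rw [LieRing.of_associative_ring_bracket]
  exact sub_mem (mul_mem_graded hS hT) (add_comm n m ▸ mul_mem_graded hT hS)

lemma lie_mem_lowering {m n : ℤ} {S T : Op} (hS : S ∈ lowering m) (hT : T ∈ lowering n) :
    ⁅S, T⁆ ∈ lowering (m + n) := by
  rw [LieRing.of_associative_ring_bracket]
  exact sub_mem (mul_mem_lowering hS hT) (add_comm n m ▸ mul_mem_lowering hT hS)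

lemma tsum_mem_graded {ι : Type*} {T : ι → Op} (hT : Summable T) {n : ℤ}
    (h : ∀ i, T i ∈ graded n) : ∑' i, T i ∈ graded n := by
  rw [mem_graded, lie_tsum hT, ← tsum_const_smul'']
  exact tsum_congr fun i => h i

/-- The vacuum eigenvalue of d is a scalar and drops out of every bracket. -/
lemma lie_gradingOp (j k : ℂ) (T : Op) : ⁅gradingOp j k, T⁆ = ⁅weightOp, T⁆ := by
  simp [gradingOp, LieRing.of_associative_ring_bracket, add_mul, mul_add]

lemma mode_mem_graded (j k : ℂ) (i : Fin 3) (n : ℤ) : mode j k i n ∈ graded n :=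
  (lie_gradingOp j k _).symm.trans (lie_gradingOp_mode j k i n)

/-- Characteristic zero: the coefficient of `s` in `v`, times the nonzero exponent `s o`, is a
coefficient of the derivative along `o`. -/
lemma eq_C_of_pderiv_eq_zero {v : Fock} (hv : ∀ o, MvPolynomial.pderiv o v = 0) :
    v = MvPolynomial.C (MvPolynomial.coeff 0 v) := by
  classical
  ext s
  rw [MvPolynomial.coeff_C]
  split_ifs with hs
  · rw [hs]
  obtain ⟨o, ho⟩ := Finsupp.ne_iff.mp (Ne.symm hs)
  have h := congrArg (MvPolynomial.coeff (s - Finsupp.single o 1)) (hv o)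
  rw [MvPolynomial.coeff_pderiv, tsub_add_cancel_of_le
    (Finsupp.single_le_iff.mpr (Nat.one_le_iff_ne_zero.mpr ho)), MvPolynomial.coeff_zero] at h
  exact (mul_eq_zero.mp h).resolve_right (Nat.cast_add_one_ne_zero _)

lemma weightOp_one : weightOp 1 = 0 := by
  simp [weightOp]

/-- Nondegeneracy of the Heisenberg form, and the reason why level -2 is excluded: each annihilation
mode is a nonzero multiple of a partial derivative. -/
lemma bosonNorm_ne_zero {k : ℂ} (hk : k ≠ 0) (hk' : k ≠ -2) (i : Fin 3) : bosonNorm k i ≠ 0 := by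
  have : k + 2 ≠ 0 := fun h => hk' (eq_neg_of_add_eq_zero_left h)
  fin_cases i <;> simp [bosonNorm, hk, this]

lemma mode_neg (j k : ℂ) (o : Osc) :
    mode j k o.1.1 (-(o.1.2 : ℤ)) = LinearMap.mulLeft ℂ (MvPolynomial.X o) := by
  have h := o.2
  rw [mode, dif_pos (by simpa using h), if_pos (by have := h.1; omega)]
  congr
  simp

lemma mode_pos (j k : ℂ) (o : Osc) :
    mode j k o.1.1 (o.1.2 : ℤ) =
      (bosonNorm k o.1.1 * (o.1.2 : ℂ)) • (MvPolynomial.pderiv o).toLinearMap := by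
  have h := o.2
  rw [mode, dif_pos (by simpa using h), if_neg (by omega)]
  simp

/-- A vector killed by all annihilation operators is a multiple of the vacuum. -/
lemma eq_smul_one_of_mode_eq_zero {j k : ℂ} (hk : k ≠ 0) (hk' : k ≠ -2) {v : Fock}
    (hv : ∀ i, ∀ n : ℤ, 0 < n → mode j k i n v = 0) : ∃ r : ℂ, v = r • (1 : Fock) := by
  refine ⟨MvPolynomial.coeff 0 v, ?_⟩
  rw [← MvPolynomial.C_eq_smul_one]
  refine eq_C_of_pderiv_eq_zero fun o => ?_
  have h := hv o.1.1 o.1.2 (by exact_mod_cast o.2.1)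
  rw [mode_pos, LinearMap.smul_apply] at h
  refine (smul_eq_zero.mp h).resolve_left (mul_ne_zero (bosonNorm_ne_zero hk hk' _) ?_)
  exact_mod_cast o.2.1.ne'

/-- A vector of nonzero weight killed by all annihilation operators vanishes. -/
lemma eq_zero_of_mode_eq_zero {j k : ℂ} (hk : k ≠ 0) (hk' : k ≠ -2) {v : Fock} {w : ℂ} (hw : w ≠ 0)
    (hv : ∀ i, ∀ n : ℤ, 0 < n → mode j k i n v = 0) (hd : weightOp v = w • v) : v = 0 := by
  obtain ⟨r, rfl⟩ := eq_smul_one_of_mode_eq_zero hk hk' hv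
  rw [map_smul, weightOp_one, smul_zero] at hd
  exact (smul_eq_zero.mp hd.symm).resolve_left hw

lemma weightOp_apply_one {T : Op} {n : ℤ} (hT : T ∈ graded n) :
    weightOp (T 1) = (-(n : ℂ)) • T 1 := by
  have h := LinearMap.congr_fun (mem_graded.mp hT) 1
  rw [LieRing.of_associative_ring_bracket, LinearMap.sub_apply, Module.End.mul_apply,
    Module.End.mul_apply, weightOp_one, map_zero, sub_zero] at h
  exact h

/-- An induction principle: a family of operators which vanishes on the vacuum, and which is
closed under brackets with creation operators up to linear combinations, vanishes. -/
lemma eq_zero_of_lie_mode {ι : Type*} {j k : ℂ} {H : ι → Op} (h1 : ∀ a, H a 1 = 0)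
    (hc : ∀ a i n, ⁅mode j k i n, H a⁆ ∈ Submodule.span ℂ (Set.range H)) (a : ι) : H a = 0 := by
  refine LinearMap.ext fun v => ?_
  suffices ∀ T ∈ Submodule.span ℂ (Set.range H), T v = 0 from
    this _ (Submodule.subset_span ⟨a, rfl⟩)
  have key (w : Fock) (hw : ∀ a, H a w = 0) : ∀ T ∈ Submodule.span ℂ (Set.range H), T w = 0 := by
    intro T hT
    induction hT using Submodule.span_induction with
    | mem x hx => obtain ⟨a, rfl⟩ := hx; exact hw a
    | zero => rfl
    | add x y _ _ hx hy => rw [LinearMap.add_apply, hx, hy, add_zero]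
    | smul r x _ hx => rw [LinearMap.smul_apply, hx, smul_zero]
  refine key v ?_
  clear a
  induction v using MvPolynomial.induction_on with
  | C r =>
    intro a
    rw [MvPolynomial.C_eq_smul_one, map_smul, h1, smul_zero]
  | add p q hp hq => intro a; rw [map_add, hp, hq, add_zero]
  | mul_X p o hp =>
    intro a
    -- As `H a p = 0`, the bracket of a creation mode with `H a`, applied to `p`, is `-H a (X o *
    -- p)`; by `key` it vanishes.
    have h := key p hp _ (hc a o.1.1 (-(o.1.2 : ℤ)))
    rw [LieRing.of_associative_ring_bracket, LinearMap.sub_apply, Module.End.mul_apply,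
      Module.End.mul_apply, hp a, map_zero, zero_sub, neg_eq_zero, mode_neg,
      LinearMap.mulLeft_apply, mul_comm] at h
    exact h

/-- A homogeneous operator which commutes with all modes is a scalar, of degree zero. -/
lemma eq_of_commute_mode {j k : ℂ} (hk : k ≠ 0) (hk' : k ≠ -2) {T : Op} {n : ℤ} (hT : T ∈ graded n)
    (hc : ∀ i m, ⁅mode j k i m, T⁆ = 0) (c : ℂ) (h0 : n = 0 → T 1 = c • (1 : Fock)) :
    T = (if n = 0 then c else 0) • (1 : Op) := by
  -- Annihilation modes commute with `T` and kill the vacuum, so they kill `T 1`.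
  have hv (i) (m : ℤ) (hm : 0 < m) : mode j k i m (T 1) = 0 := by
    have h := LinearMap.congr_fun (hc i m) 1
    rw [LieRing.of_associative_ring_bracket, LinearMap.sub_apply, Module.End.mul_apply,
      Module.End.mul_apply, mode_vacuum j k i hm, map_zero, sub_zero] at h
    exact h
  rw [← sub_eq_zero]
  refine eq_zero_of_lie_mode (j := j) (k := k)
    (H := fun _ : Unit => T - (if n = 0 then c else 0) • (1 : Op)) (fun _ => ?_)
    (fun _ i m => ?_) ()
  · rw [LinearMap.sub_apply, LinearMap.smul_apply, Module.End.one_apply]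
    split_ifs with hn
    · rw [h0 hn, sub_self]
    · rw [zero_smul, sub_zero]
      exact eq_zero_of_mode_eq_zero hk hk' (neg_ne_zero.mpr (Int.cast_ne_zero.mpr hn)) hv
        (weightOp_apply_one hT)
  · have : ⁅mode j k i m, T - (if n = 0 then c else 0) • (1 : Op)⁆ = 0 := by
      rw [lie_sub, hc, LieRing.of_associative_ring_bracket]
      simp
    rw [this]
    exact zero_mem _

/-! ### Exponentials -/

lemma coeff_pow_eq_zero {u : PowerSeries Op} (h0 : PowerSeries.coeff 0 u = 0) {n r : ℕ}
    (h : n < r) : PowerSeries.coeff n (u ^ r) = 0 := by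
  induction r generalizing n with
  | zero => omega
  | succ r ih =>
    rw [pow_succ, PowerSeries.coeff_mul]
    refine Finset.sum_eq_zero fun pq hpq => ?_
    have hs := Finset.HasAntidiagonal.mem_antidiagonal.mp hpq
    by_cases hp : pq.1 < r
    · rw [ih hp, zero_mul]
    · rw [show pq.2 = 0 by omega, h0, mul_zero]

lemma coeff_expSeries {u : PowerSeries Op} (h0 : PowerSeries.coeff 0 u = 0) {n N : ℕ}
    (h : n < N) : PowerSeries.coeff n (expSeries u) =
      ∑ r ∈ Finset.range N, ((r ! : ℂ)⁻¹) • PowerSeries.coeff n (u ^ r) := by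
  rw [expSeries, PowerSeries.coeff_mk]
  refine Finset.sum_subset (Finset.range_mono h) fun r _ hr => ?_
  rw [coeff_pow_eq_zero h0 (by simpa using hr), smul_zero]

lemma coeff_zero_expSeries (u : PowerSeries Op) : PowerSeries.coeff 0 (expSeries u) = 1 := by
  simp [expSeries]

/-- The bracket of `T` with `u` is the central series s X^L, so bracketing with `T` differentiates
powers of `u` as in the commutative case. -/
lemma lie_coeff_pow {u : PowerSeries Op} {T : Op} {L : ℕ} {s : ℂ}
    (hu : ∀ p, ⁅T, PowerSeries.coeff p u⁆ = if p = L then s • (1 : Op) else 0) (r n : ℕ) :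
    ⁅T, PowerSeries.coeff n (u ^ (r + 1))⁆ =
      if L ≤ n then ((r + 1 : ℂ) * s) • PowerSeries.coeff (n - L) (u ^ r) else 0 := by
  have h1 : PowerSeries.C T * u - u * PowerSeries.C T = s • PowerSeries.X ^ L := by
    ext1 p
    rw [map_sub, PowerSeries.coeff_C_mul, PowerSeries.coeff_mul_C,
      ← LieRing.of_associative_ring_bracket, hu, PowerSeries.coeff_smul, PowerSeries.coeff_X_pow]
    split_ifs <;> simp
  have h2 (r : ℕ) : PowerSeries.C T * u ^ (r + 1) - u ^ (r + 1) * PowerSeries.C T =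
      ((r + 1 : ℂ) * s) • (u ^ r * PowerSeries.X ^ L) := by
    induction r with
    | zero => simpa using h1
    | succ r ih =>
      have e : PowerSeries.C T * u ^ (r + 1 + 1) - u ^ (r + 1 + 1) * PowerSeries.C T =
          (PowerSeries.C T * u ^ (r + 1) - u ^ (r + 1) * PowerSeries.C T) * u +
            u ^ (r + 1) * (PowerSeries.C T * u - u * PowerSeries.C T) := by
        rw [pow_succ u (r + 1)]
        simp only [sub_mul, mul_sub, mul_assoc]
        abel
      rw [e, ih, h1, smul_mul_assoc, mul_assoc, (PowerSeries.commute_X_pow u L).symm.eq,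
        ← mul_assoc, ← pow_succ, mul_smul_comm, ← add_smul]
      congr 1
      push_cast
      ring
  have h3 := congrArg (PowerSeries.coeff n) (h2 r)
  rw [map_sub, PowerSeries.coeff_C_mul, PowerSeries.coeff_mul_C,
    ← LieRing.of_associative_ring_bracket, PowerSeries.coeff_smul,
    PowerSeries.coeff_mul_X_pow'] at h3
  rw [h3, smul_ite, smul_zero]

/-- If `[T, u]` is a scalar monomial of degree `L`, then `[T, exp u] = [T, u] exp u`. -/
lemma lie_coeff_expSeries {u : PowerSeries Op} (h0 : PowerSeries.coeff 0 u = 0) {T : Op} {L : ℕ}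
    {s : ℂ} (hL : 0 < L)
    (hu : ∀ p, ⁅T, PowerSeries.coeff p u⁆ = if p = L then s • (1 : Op) else 0) (n : ℕ) :
    ⁅T, PowerSeries.coeff n (expSeries u)⁆ =
      if L ≤ n then s • PowerSeries.coeff (n - L) (expSeries u) else 0 := by
  have hz : ⁅T, ((0 ! : ℂ)⁻¹) • PowerSeries.coeff n (u ^ 0)⁆ = 0 := by
    rw [pow_zero, PowerSeries.coeff_one]
    split_ifs <;> simp [LieRing.of_associative_ring_bracket]
  rw [expSeries, PowerSeries.coeff_mk, lie_sum, Finset.sum_range_succ', hz, add_zero]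
  split_ifs with hn
  -- The term r = 0 is scalar and has dropped out; the shift r ↦ r + 1 with (r + 1)/(r + 1)! = 1/r!
  -- restores the exponential. The n remaining terms suffice because n - L < n.
  · rw [← expSeries, coeff_expSeries h0 (show n - L < n by omega), Finset.smul_sum]
    refine Finset.sum_congr rfl fun r _ => ?_
    rw [op_lie_smul, lie_coeff_pow hu, if_pos hn, smul_smul, smul_smul]
    congr 1
    rw [Nat.factorial_succ]
    have h1 : ((r + 1 : ℕ) : ℂ) ≠ 0 := Nat.cast_ne_zero.mpr r.succ_ne_zero
    have h2 : (r ! : ℂ) ≠ 0 := Nat.cast_ne_zero.mpr r.factorial_ne_zero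
    push_cast at h1 ⊢
    field_simp
  · refine Finset.sum_eq_zero fun r _ => ?_
    rw [op_lie_smul, lie_coeff_pow hu, if_neg hn, smul_zero]

lemma lie_coeff_expSeries_eq_zero {u : PowerSeries Op} (h0 : PowerSeries.coeff 0 u = 0) {T : Op}
    (hu : ∀ p, ⁅T, PowerSeries.coeff p u⁆ = 0) (n : ℕ) :
    ⁅T, PowerSeries.coeff n (expSeries u)⁆ = 0 := by
  rw [lie_coeff_expSeries h0 (L := 1) (s := 0) one_pos (by simpa using hu)]
  simp

lemma coeff_expSeries_mem_graded (ε : ℤ) {u : PowerSeries Op}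
    (hu : ∀ n : ℕ, PowerSeries.coeff n u ∈ graded (ε * n)) (n : ℕ) :
    PowerSeries.coeff n (expSeries u) ∈ graded (ε * n) := by
  have hp (r n : ℕ) : PowerSeries.coeff n (u ^ r) ∈ graded (ε * n) := by
    induction r generalizing n with
    | zero =>
      rw [pow_zero, PowerSeries.coeff_one]
      split_ifs with h
      · simpa [h] using one_mem_graded
      · exact zero_mem _
    | succ r ih =>
      rw [pow_succ, PowerSeries.coeff_mul]
      refine sum_mem fun pq hpq => ?_
      have := mul_mem_graded (ih pq.1) (hu pq.2)
      rwa [← mul_add, ← Nat.cast_add, Finset.HasAntidiagonal.mem_antidiagonal.mp hpq] at this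
  rw [expSeries, PowerSeries.coeff_mk]
  exact sum_mem fun r _ => Submodule.smul_mem _ _ (hp r n)

/-! ### The modes of `φ₂ / k + φ₀ / k` -/

/-- The coefficient of `ζ ^ (-n)` in `φ₂(ζ) / k + φ₀(ζ) / k`. -/
def expMode (j k : ℂ) (n : ℤ) : Op := (1 / k) • (fieldCoeff j k 2 n + fieldCoeff j k 0 n)

/-- The indicator function of the odd numbers. -/
def oddInd (l : ℤ) : ℂ := if Odd l then 1 else 0

/-- The vertex operator `exp (φ₂ / k + φ₀ / k)` has charge `charge i` with respect to `φ_i`. -/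
def charge (i : Fin 3) : ℂ := ![4, 0, -4] i

lemma mode_eq_zero (j k : ℂ) {i : Fin 3} {n : ℤ} (h : ¬(Even n ↔ i = 1)) : mode j k i n = 0 := by
  rw [mode, dif_neg (by rw [Int.natAbs_even]; exact fun h' => h h'.2), if_neg]
  rintro ⟨rfl, rfl⟩
  simp at h

/-- The parity hypotheses of `lie_mode` can go because modes of the wrong parity are zero; one
parity condition is left, since m + n = 0 forces equal parities. -/
lemma lie_mode_mode (j k : ℂ) (i i' : Fin 3) (m n : ℤ) :
    ⁅mode j k i m, mode j k i' n⁆ =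
      if i = i' ∧ m + n = 0 ∧ (Even m ↔ i = 1) then (bosonNorm k i * m) • (1 : Op) else 0 := by
  by_cases hm : Even m ↔ i = 1
  · by_cases hn : Even n ↔ i' = 1
    · simpa only [hm, and_true] using lie_mode j k i i' m n hm hn
    · rw [mode_eq_zero j k hn, lie_zero, if_neg]
      rintro ⟨rfl, h, -⟩
      apply hn
      rwa [show n = -m by omega, even_neg]
  · rw [mode_eq_zero j k hm, zero_lie, if_neg (by tauto)]

/-- The factor l of the Heisenberg bracket cancels the 1/l in φ_i, and the k in the norm cancels
1/k; what remains is ±4, independent of l. -/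
lemma lie_mode_expMode {j k : ℂ} (hk : k ≠ 0) (i : Fin 3) (l n : ℤ) :
    ⁅mode j k i l, expMode j k n⁆ =
      (if l + n = 0 then charge i * oddInd l else 0) • (1 : Op) := by
  rw [expMode, fieldCoeff, fieldCoeff, op_lie_smul, lie_add, op_lie_smul, op_lie_smul,
    lie_mode_mode, lie_mode_mode]
  by_cases h : l + n = 0
  · obtain rfl : n = -l := by omega
    by_cases hl : Odd l
    · have hl' : ¬Even l := Int.not_even_iff_odd.mpr hl
      have hl0 : (l : ℂ) ≠ 0 := by
        rintro h0
        rw [Int.cast_eq_zero.mp h0] at hl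
        simp at hl
      have e : k⁻¹ * (((l : ℂ))⁻¹ * (4 * k * l)) = 4 := by field_simp
      fin_cases i <;> simp [oddInd, charge, hl, hl', bosonNorm, smul_smul, e]
      exact (neg_smul (4 : ℂ) (1 : Op)).symm
    · have hl' : Even l := Int.not_odd_iff_even.mp hl
      fin_cases i <;> simp [oddInd, hl, hl']
  · simp [h]

lemma lie_expMode_of_charge {j k : ℂ} {T : Op}
    (hT : ∀ n, ⁅mode j k 2 n, T⁆ + ⁅mode j k 0 n, T⁆ = 0) (n : ℤ) : ⁅expMode j k n, T⁆ = 0 := by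
  rw [expMode, fieldCoeff, fieldCoeff, ← smul_add, op_smul_lie, op_smul_lie, add_lie, hT, smul_zero,
    smul_zero]

lemma expMode_mem_graded (j k : ℂ) (n : ℤ) : expMode j k n ∈ graded n :=
  Submodule.smul_mem _ _ (add_mem (Submodule.smul_mem _ _ (mode_mem_graded j k 2 n))
    (Submodule.smul_mem _ _ (mode_mem_graded j k 0 n)))

lemma coeff_creationPart (j k : ℂ) (p : ℕ) :
    PowerSeries.coeff p (creationPart j k) = if p = 0 then 0 else expMode j k (-p) := by
  rw [creationPart, PowerSeries.coeff_mk]; rfl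

lemma coeff_annihilationPart (j k : ℂ) (p : ℕ) :
    PowerSeries.coeff p (annihilationPart j k) = if p = 0 then 0 else expMode j k p := by
  rw [annihilationPart, PowerSeries.coeff_mk]; rfl

/-- The coefficient of `ζ ^ p` in the exponential of the creation part. -/
def expCr (j k : ℂ) (p : ℤ) : Op :=
  if 0 ≤ p then PowerSeries.coeff p.toNat (expSeries (creationPart j k)) else 0

/-- The coefficient of `ζ ^ (-q)` in the exponential of the annihilation part. -/
def expAn (j k : ℂ) (q : ℤ) : Op :=
  if 0 ≤ q then PowerSeries.coeff q.toNat (expSeries (annihilationPart j k)) else 0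

lemma expCr_natCast (j k : ℂ) (p : ℕ) :
    expCr j k p = PowerSeries.coeff p (expSeries (creationPart j k)) := by
  simp [expCr]

lemma expAn_natCast (j k : ℂ) (p : ℕ) :
    expAn j k p = PowerSeries.coeff p (expSeries (annihilationPart j k)) := by
  simp [expAn]

lemma expCr_of_neg (j k : ℂ) {p : ℤ} (hp : p < 0) : expCr j k p = 0 := if_neg (by omega)

lemma expAn_of_neg (j k : ℂ) {p : ℤ} (hp : p < 0) : expAn j k p = 0 := if_neg (by omega)

lemma expCr_zero (j k : ℂ) : expCr j k 0 = 1 := by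
  simp [expCr, coeff_zero_expSeries]

lemma expAn_zero (j k : ℂ) : expAn j k 0 = 1 := by
  simp [expAn, coeff_zero_expSeries]

/-- Only positive modes fail to commute with the creation part. Since `expCr` is zero at negative
indices, no separate case is needed when p < l. -/
lemma lie_mode_expCr {j k : ℂ} (hk : k ≠ 0) (i : Fin 3) (l p : ℤ) :
    ⁅mode j k i l, expCr j k p⁆ =
      if 0 < l then (charge i * oddInd l) • expCr j k (p - l) else 0 := by
  rcases lt_or_ge p 0 with hp | hp
  · rw [expCr_of_neg j k hp, lie_zero]
    split_ifs with hl
    · rw [expCr_of_neg j k (by omega), smul_zero]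
    · rfl
  lift p to ℕ using hp
  rw [expCr_natCast]
  split_ifs with hl
  · lift l to ℕ using hl.le
    rw [lie_coeff_expSeries (by simp [coeff_creationPart]) (L := l) (s := charge i * oddInd l)
      (by omega)]
    · split_ifs with h
      · rw [← Nat.cast_sub h, expCr_natCast]
      · rw [expCr_of_neg j k (by omega), smul_zero]
    · intro q
      rw [coeff_creationPart]
      split_ifs with h0 h1 h1
      · omega
      · rw [lie_zero]
      · rw [lie_mode_expMode hk, if_pos (by omega)]
      · rw [lie_mode_expMode hk, if_neg (by omega), zero_smul]
  · refine lie_coeff_expSeries_eq_zero (by simp [coeff_creationPart]) (fun q => ?_) p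
    rw [coeff_creationPart]
    split_ifs with h0
    · rw [lie_zero]
    · rw [lie_mode_expMode hk, if_neg (by omega), zero_smul]

lemma lie_mode_expAn {j k : ℂ} (hk : k ≠ 0) (i : Fin 3) (l q : ℤ) :
    ⁅mode j k i l, expAn j k q⁆ =
      if l < 0 then (charge i * oddInd l) • expAn j k (q + l) else 0 := by
  rcases lt_or_ge q 0 with hp | hp
  · rw [expAn_of_neg j k hp, lie_zero]
    split_ifs with hl
    · rw [expAn_of_neg j k (by omega), smul_zero]
    · rfl
  lift q to ℕ using hp
  rw [expAn_natCast]
  split_ifs with hl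
  · obtain ⟨m, rfl⟩ : ∃ m : ℕ, l = -m := ⟨l.natAbs, by omega⟩
    rw [lie_coeff_expSeries (by simp [coeff_annihilationPart]) (L := m)
      (s := charge i * oddInd (-m)) (by omega)]
    · split_ifs with h
      · rw [← sub_eq_add_neg, ← Nat.cast_sub h, expAn_natCast]
      · rw [expAn_of_neg j k (by omega), smul_zero]
    · intro p
      rw [coeff_annihilationPart]
      split_ifs with h0 h1 h1
      · omega
      · rw [lie_zero]
      · rw [lie_mode_expMode hk, if_pos (by omega)]
      · rw [lie_mode_expMode hk, if_neg (by omega), zero_smul]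
  · refine lie_coeff_expSeries_eq_zero (by simp [coeff_annihilationPart]) (fun p => ?_) q
    rw [coeff_annihilationPart]
    split_ifs with h0
    · rw [lie_zero]
    · rw [lie_mode_expMode hk, if_neg (by omega), zero_smul]

/-- The opposite norms of φ₀ and φ₂ make φ₀ + φ₂ isotropic; this neutrality is why the vertex modes
commute. -/
lemma charge_two_add_zero (a : ℂ) (T : Op) : (charge 2 * a) • T + (charge 0 * a) • T = 0 := by
  rw [← add_smul]
  simp [charge]

lemma lie_expCr_of_lie_expMode {j k : ℂ} {T : Op} (hT : ∀ n, ⁅expMode j k n, T⁆ = 0) (p : ℤ) :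
    ⁅T, expCr j k p⁆ = 0 := by
  rw [expCr]
  split_ifs
  · refine lie_coeff_expSeries_eq_zero (by simp [coeff_creationPart]) (fun q => ?_) _
    rw [coeff_creationPart]
    split_ifs
    · rw [lie_zero]
    · rw [← lie_skew, hT, neg_zero]
  · rw [lie_zero]

lemma lie_expAn_of_lie_expMode {j k : ℂ} {T : Op} (hT : ∀ n, ⁅expMode j k n, T⁆ = 0) (p : ℤ) :
    ⁅T, expAn j k p⁆ = 0 := by
  rw [expAn]
  split_ifs
  · refine lie_coeff_expSeries_eq_zero (by simp [coeff_annihilationPart]) (fun q => ?_) _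
    rw [coeff_annihilationPart]
    split_ifs
    · rw [lie_zero]
    · rw [← lie_skew, hT, neg_zero]
  · rw [lie_zero]

lemma expCr_mem_lowering (j k : ℂ) (p : ℤ) : expCr j k p ∈ lowering (-p) := by
  rcases lt_or_ge p 0 with hp | hp
  · rw [expCr_of_neg j k hp]; exact zero_mem _
  · lift p to ℕ using hp
    rw [expCr_natCast]
    exact creation_mem_lowering j k p

lemma expAn_mem_lowering (j k : ℂ) (p : ℤ) : expAn j k p ∈ lowering p := by
  rcases lt_or_ge p 0 with hp | hp
  · rw [expAn_of_neg j k hp]; exact zero_mem _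
  · lift p to ℕ using hp
    rw [expAn_natCast]
    exact annihilation_mem_lowering j k p

lemma expCr_mem_graded (j k : ℂ) (p : ℤ) : expCr j k p ∈ graded (-p) := by
  rw [expCr]
  split_ifs with hp
  · lift p to ℕ using hp
    rw [← neg_one_mul]
    refine coeff_expSeries_mem_graded (-1) (fun n => ?_) p
    rw [coeff_creationPart, neg_one_mul]
    split_ifs
    · exact zero_mem _
    · exact expMode_mem_graded j k _
  · exact zero_mem _

lemma expAn_mem_graded (j k : ℂ) (p : ℤ) : expAn j k p ∈ graded p := by
  rw [expAn]
  split_ifs with hp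
  · lift p to ℕ using hp
    have h := coeff_expSeries_mem_graded 1 (u := annihilationPart j k) (fun n => ?_) p
    · rwa [one_mul] at h
    rw [coeff_annihilationPart, one_mul]
    split_ifs
    · exact zero_mem _
    · exact expMode_mem_graded j k _
  · exact zero_mem _

/-! ### The coefficients of `exp (φ₂(ζ) / k + φ₀(ζ) / k)` -/

lemma apply_eq_zero_of_lowering {T : Op} {n D : ℤ} (hT : T ∈ lowering n) (h : D < n) {v : Fock}
    (hv : v ∈ weightLE D) : T v = 0 :=
  weightLE_eq_zero (by omega) (hT D v hv)

lemma one_mem_weightLE : (1 : Fock) ∈ weightLE 0 := by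
  intro s hs
  obtain rfl : s = 0 := by
    simpa using hs
  simp

lemma apply_one_eq_zero {T : Op} {n : ℤ} (hT : T ∈ lowering n) (h : 0 < n) : T 1 = 0 :=
  apply_eq_zero_of_lowering hT h one_mem_weightLE

/-- The coefficient of `ζ ^ (-n)` in `exp (φ₂(ζ) / k + φ₀(ζ) / k)`. -/
def vertex (j k : ℂ) (n : ℤ) : Op := ∑' p : ℤ, expCr j k p * expAn j k (p + n)

lemma summable_vertex (j k : ℂ) (n : ℤ) :
    Summable fun p : ℤ => expCr j k p * expAn j k (p + n) := by
  refine summable_of_weightLE fun D => ⟨Set.Icc 0 (D - n), Set.finite_Icc _ _, fun p hp v hv => ?_⟩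
  rw [Set.mem_Icc, not_and_or, not_le, not_le] at hp
  rcases hp with hp | hp
  · rw [expCr_of_neg j k hp, zero_mul, LinearMap.zero_apply]
  · rw [Module.End.mul_apply, apply_eq_zero_of_lowering (expAn_mem_lowering j k _) (by omega) hv,
      map_zero]

lemma vertex_mem_lowering (j k : ℂ) (n : ℤ) : vertex j k n ∈ lowering n := by
  refine tsum_mem_lowering (summable_vertex j k n) fun p => ?_
  have := mul_mem_lowering (expCr_mem_lowering j k p) (expAn_mem_lowering j k (p + n))
  rwa [neg_add_cancel_left] at this

lemma vertex_mem_graded (j k : ℂ) (n : ℤ) : vertex j k n ∈ graded n := by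
  refine tsum_mem_graded (summable_vertex j k n) fun p => ?_
  have := mul_mem_graded (expCr_mem_graded j k p) (expAn_mem_graded j k (p + n))
  rwa [neg_add_cancel_left] at this

lemma vertex_zero_apply_one (j k : ℂ) : vertex j k 0 1 = 1 := by
  rw [vertex, tsum_apply_eq_sum_of_eq_zero (summable_vertex j k 0) {0}]
  · simp [expCr_zero, expAn_zero]
  · intro p hp
    rw [add_zero, Module.End.mul_apply]
    rcases lt_or_gt_of_ne (by simpa using hp : p ≠ 0) with h | h
    · rw [expAn_of_neg j k h, LinearMap.zero_apply, map_zero]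
    · rw [apply_one_eq_zero (expAn_mem_lowering j k p) h, map_zero]

/-- For l > 0 only the creation factor contributes, for l < 0 only the annihilation factor, and l =
0 is even. A shift of the summation index brings the first case to the form of the second. -/
lemma lie_mode_vertex {j k : ℂ} (hk : k ≠ 0) (i : Fin 3) (l n : ℤ) :
    ⁅mode j k i l, vertex j k n⁆ = (charge i * oddInd l) • vertex j k (n + l) := by
  rw [vertex, lie_tsum (summable_vertex j k n), vertex, ← tsum_const_smul'']
  have h (p : ℤ) : ⁅mode j k i l, expCr j k p * expAn j k (p + n)⁆ =
      if 0 < l then (charge i * oddInd l) • (expCr j k (p - l) * expAn j k ((p - l) + (n + l)))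
      else (charge i * oddInd l) • (expCr j k p * expAn j k (p + (n + l))) := by
    rw [lie_mul, lie_mode_expCr hk, lie_mode_expAn hk]
    rcases lt_trichotomy l 0 with hl | rfl | hl
    · simp [hl, hl.not_gt, add_assoc]
    · simp [oddInd]
    · simp [hl, hl.not_gt, show p - l + (n + l) = p + n by omega]
  simp only [h]
  split_ifs with hl
  · exact (Equiv.subRight l).tsum_eq
      fun p => (charge i * oddInd l) • (expCr j k p * expAn j k (p + (n + l)))
  · rfl

lemma lie_vertex_vertex {j k : ℂ} (hk : k ≠ 0) (m n : ℤ) :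
    ⁅vertex j k m, vertex j k n⁆ = 0 := by
  have h (l : ℤ) : ⁅expMode j k l, vertex j k m⁆ = 0 := by
    refine lie_expMode_of_charge (fun l => ?_) l
    rw [lie_mode_vertex hk, lie_mode_vertex hk]
    exact charge_two_add_zero _ _
  rw [vertex.eq_def j k n, lie_tsum (summable_vertex j k n)]
  simp [lie_mul, lie_expCr_of_lie_expMode h, lie_expAn_of_lie_expMode h]

lemma vertex_mul_comm {j k : ℂ} (hk : k ≠ 0) (m n : ℤ) :
    vertex j k m * vertex j k n = vertex j k n * vertex j k m :=
  sub_eq_zero.mp (lie_vertex_vertex hk m n)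

/-! ### Products of two vertex operators -/

lemma summable_vertex_mul {j k : ℂ} (hk : k ≠ 0) (c : ℤ → ℂ) (N l : ℤ) :
    Summable fun a : ℤ => c a • (vertex j k (N - a) * vertex j k (l + a)) := by
  refine summable_of_weightLE fun D =>
    ⟨Set.Icc (N - D) (D - l), Set.finite_Icc _ _, fun a ha v hv => ?_⟩
  rw [Set.mem_Icc, not_and_or, not_le, not_le] at ha
  rw [LinearMap.smul_apply]
  rcases ha with ha | ha
  · rw [vertex_mul_comm hk, Module.End.mul_apply,
      apply_eq_zero_of_lowering (vertex_mem_lowering j k _) (by omega) hv, map_zero, smul_zero]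
  · rw [Module.End.mul_apply,
      apply_eq_zero_of_lowering (vertex_mem_lowering j k _) (by omega) hv, map_zero, smul_zero]

/-- For n ≠ 0 one of the two commuting factors has positive degree and kills the vacuum. -/
lemma vertex_mul_apply_one {j k : ℂ} (hk : k ≠ 0) (n : ℤ) :
    (vertex j k n * vertex j k (-n)) 1 = if n = 0 then 1 else 0 := by
  split_ifs with hn
  · subst hn
    rw [neg_zero, Module.End.mul_apply, vertex_zero_apply_one, vertex_zero_apply_one]
  rcases lt_or_gt_of_ne hn with h | h
  · rw [Module.End.mul_apply, apply_one_eq_zero (vertex_mem_lowering j k _) (by omega), map_zero]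
  · rw [vertex_mul_comm hk, Module.End.mul_apply,
      apply_one_eq_zero (vertex_mem_lowering j k _) (by omega), map_zero]

lemma tsum_vertex_mul_apply_one {j k : ℂ} (hk : k ≠ 0) (c : ℤ → ℂ) (N : ℤ) :
    (∑' a : ℤ, c a • (vertex j k (N - a) * vertex j k (-N + a))) 1 = c N • (1 : Fock) := by
  have e (a : ℤ) : -N + a = -(N - a) := by ring
  rw [tsum_apply_eq_sum_of_eq_zero (summable_vertex_mul hk c N (-N)) {N}]
  · rw [Finset.sum_singleton, LinearMap.smul_apply, e, vertex_mul_apply_one hk,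
      if_pos (sub_self N)]
  · intro a ha
    rw [LinearMap.smul_apply, e, vertex_mul_apply_one hk, if_neg, smul_zero]
    rw [Finset.mem_singleton] at ha
    omega

lemma neg_one_zpow_add (a b : ℤ) : (-1 : ℂ) ^ (a + b) = (-1) ^ a * (-1) ^ b :=
  zpow_add₀ (by norm_num) a b

/-- `exp (φ(ζ)) exp (φ(-ζ)) = 1` for the odd field `φ = φ₂ / k + φ₀ / k`. -/
lemma tsum_neg_one_pow_vertex_mul {j k : ℂ} (hk : k ≠ 0) (hk' : k ≠ -2) (N l : ℤ) :
    ∑' a : ℤ, ((-1 : ℂ) ^ a) • (vertex j k (N - a) * vertex j k (l + a)) =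
      (if N + l = 0 then (-1 : ℂ) ^ N else 0) • (1 : Op) := by
  have hs := summable_vertex_mul (j := j) hk (fun a => (-1 : ℂ) ^ a) N l
  refine eq_of_commute_mode (j := j) hk hk' (tsum_mem_graded hs fun a => ?_) (fun i m => ?_) _
    fun h => ?_
  · have := mul_mem_graded (vertex_mem_graded j k (N - a)) (vertex_mem_graded j k (l + a))
    rw [show N - a + (l + a) = N + l by ring] at this
    exact Submodule.smul_mem _ _ this
  · rw [lie_tsum hs]
    -- The first half is the second with its index shifted by m, so its sum is (-1)^m times the sum
    -- of the second. For odd m they cancel; for even m the prefactor `oddInd m` is zero.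
    have e (a : ℤ) : ⁅mode j k i m, ((-1 : ℂ) ^ a) • (vertex j k (N - a) * vertex j k (l + a))⁆ =
        (charge i * oddInd m) •
          ((-1 : ℂ) ^ a) • (vertex j k (N - (a - m)) * vertex j k (l + m + (a - m))) +
        (charge i * oddInd m) • ((-1 : ℂ) ^ a) • (vertex j k (N - a) * vertex j k (l + m + a)) := by
      rw [op_lie_smul, lie_mul, lie_mode_vertex hk, lie_mode_vertex hk,
        show N - (a - m) = N - a + m by ring, show l + m + (a - m) = l + a by ring,
        show l + a + m = l + m + a by ring, smul_mul_assoc, mul_smul_comm, smul_add,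
        smul_comm ((-1 : ℂ) ^ a), smul_comm ((-1 : ℂ) ^ a)]
    simp only [e]
    have h2 := (summable_vertex_mul (j := j) hk (fun a => (-1 : ℂ) ^ a) N (l + m)).hasSum
    have h1 := (Equiv.subRight m).hasSum_iff.mpr h2
    have h3 := ((h1.const_smul ((-1 : ℂ) ^ m)).add h2).const_smul (charge i * oddInd m)
    simp only [Function.comp_def, Equiv.subRight_apply, smul_smul, ← neg_one_zpow_add,
      add_sub_cancel, smul_add] at h3
    simp only [smul_smul]
    rw [h3.tsum_eq, oddInd]
    split_ifs with hm
    · rw [hm.neg_one_zpow, ← smul_smul, neg_one_smul, ← smul_add, neg_add_cancel, smul_zero]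
    · simp
  · obtain rfl : l = -N := by omega
    exact tsum_vertex_mul_apply_one hk _ N

/-! ### The current `:(D φ₁ + D φ₂) exp (φ₂ / k + φ₀ / k):` -/

/-- The coefficient of `ζ ^ (-m)` in `(D φ₁ + D φ₂)(ζ)`. -/
def boson (j k : ℂ) (m : ℤ) : Op := DField j k 1 m + DField j k 2 m

/-- The term of `:(D φ₁ + D φ₂) exp (φ₂ / k + φ₀ / k):` of degree `-N` which contains the mode of
degree `-m` of `D φ₁ + D φ₂`. -/
def normalTerm (j k : ℂ) (N m : ℤ) : Op :=
  if 0 < m then vertex j k (N - m) * boson j k m else boson j k m * vertex j k (N - m)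

/-- The coefficient of `ζ ^ (-N)` in `:(D φ₁ + D φ₂) exp (φ₂ / k + φ₀ / k):`. -/
def current (j k : ℂ) (N : ℤ) : Op := ∑' m : ℤ, normalTerm j k N m

lemma boson_mem_lowering (j k : ℂ) (m : ℤ) : boson j k m ∈ lowering m :=
  add_mem (mode_mem_lowering _ _ _ _) (mode_mem_lowering _ _ _ _)

lemma boson_mem_graded (j k : ℂ) (m : ℤ) : boson j k m ∈ graded m :=
  add_mem (mode_mem_graded _ _ _ _) (mode_mem_graded _ _ _ _)

lemma summable_normalTerm (j k : ℂ) (N : ℤ) : Summable (normalTerm j k N) := by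
  refine summable_of_weightLE fun D => ⟨Set.Icc (min 0 (N - D)) (max 0 D), Set.finite_Icc _ _,
    fun m hm v hv => ?_⟩
  rw [Set.mem_Icc, not_and_or, not_le, not_le] at hm
  rw [normalTerm]
  split_ifs with h
  · rw [Module.End.mul_apply, apply_eq_zero_of_lowering (boson_mem_lowering j k m) (by omega) hv,
      map_zero]
  · rw [Module.End.mul_apply, apply_eq_zero_of_lowering (vertex_mem_lowering j k _) (by omega) hv,
      map_zero]

lemma normalTerm_mem_lowering (j k : ℂ) (N m : ℤ) : normalTerm j k N m ∈ lowering N := by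
  rw [normalTerm]
  split_ifs
  · have := mul_mem_lowering (vertex_mem_lowering j k (N - m)) (boson_mem_lowering j k m)
    rwa [sub_add_cancel] at this
  · have := mul_mem_lowering (boson_mem_lowering j k m) (vertex_mem_lowering j k (N - m))
    rwa [add_sub_cancel] at this

lemma normalTerm_mem_graded (j k : ℂ) (N m : ℤ) : normalTerm j k N m ∈ graded N := by
  rw [normalTerm]
  split_ifs
  · have := mul_mem_graded (vertex_mem_graded j k (N - m)) (boson_mem_graded j k m)
    rwa [sub_add_cancel] at this
  · have := mul_mem_graded (boson_mem_graded j k m) (vertex_mem_graded j k (N - m))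
    rwa [add_sub_cancel] at this

lemma current_mem_lowering (j k : ℂ) (N : ℤ) : current j k N ∈ lowering N :=
  tsum_mem_lowering (summable_normalTerm j k N) (normalTerm_mem_lowering j k N)

lemma current_mem_graded (j k : ℂ) (N : ℤ) : current j k N ∈ graded N :=
  tsum_mem_graded (summable_normalTerm j k N) (normalTerm_mem_graded j k N)

/-- Regroups the double sum by the mode m of A: then q = p + N - m, and the sum over p is a vertex
mode. The family is extended by zero from pairs of naturals to pairs of integers. -/
lemma xOp_eq (j k : ℂ) (N : ℤ) : xOp j k N = (1 / 2 : ℂ) • current j k N := by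
  rw [xOp]
  congr 1
  let F : ℤ × ℤ → Op := fun x =>
    if 0 < x.1 then expCr j k x.2 * expAn j k (x.2 + (N - x.1)) * boson j k x.1
    else boson j k x.1 * (expCr j k x.2 * expAn j k (x.2 + (N - x.1)))
  let g : ℕ × ℕ → ℤ × ℤ := fun pq => (N + pq.1 - pq.2, pq.1)
  have hg : Function.Injective g := by
    rintro ⟨p, q⟩ ⟨p', q'⟩ h
    simp only [g, Prod.mk.injEq] at h
    ext <;> simp only <;> omega
  have hF : HasSum F (locSum (currentTerm j k N) (currentTerm_finite j k N)) := by
    rw [← hg.hasSum_iff]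
    · convert hasSum_locSum (currentTerm j k N) (currentTerm_finite j k N) using 1
      ext1 pq
      have e : (pq.1 : ℤ) + (N - (N + pq.1 - pq.2)) = pq.2 := by ring
      simp only [Function.comp_apply, F, g, currentTerm, e, expCr_natCast, expAn_natCast, boson]
    · rintro ⟨m, p⟩ hmp
      have h : p < 0 ∨ p + (N - m) < 0 := by
        by_contra! h
        refine hmp ⟨(p.toNat, (p + (N - m)).toNat), ?_⟩
        simp only [g, Prod.mk.injEq]
        omega
      rcases h with h | h
      · simp [F, expCr_of_neg j k h]
      · simp [F, expAn_of_neg j k h]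
  refine (HasSum.prod_fiberwise hF (g := normalTerm j k N) fun m => ?_).tsum_eq.symm
  have hv := (summable_vertex j k (N - m)).hasSum
  simp only [F, normalTerm]
  split_ifs
  · exact hv.mul_right _
  · exact hv.mul_left _

/-- `[φ_{i,l}, D φ₁ + D φ₂]` is `curNorm k i l ζ ^ l`. -/
def curNorm (k : ℂ) (i : Fin 3) (l : ℤ) : ℂ :=
  if Even l ↔ i = 1 then ![0, 4 * (k + 2), -(4 * k)] i * l else 0

lemma lie_mode_boson (j k : ℂ) (i : Fin 3) (l m : ℤ) :
    ⁅mode j k i l, boson j k m⁆ = (if l + m = 0 then curNorm k i l else 0) • (1 : Op) := by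
  rw [boson, DField, DField, lie_add, lie_mode_mode, lie_mode_mode]
  by_cases h : l + m = 0 <;> by_cases hl : Even l <;> fin_cases i <;>
    simp [h, hl, curNorm, bosonNorm]

lemma lie_boson_vertex {j k : ℂ} (hk : k ≠ 0) (m n : ℤ) :
    ⁅boson j k m, vertex j k n⁆ = (-4 * oddInd m) • vertex j k (n + m) := by
  rw [boson, DField, DField, add_lie, lie_mode_vertex hk, lie_mode_vertex hk]
  simp [charge]

/-- The bracket with the boson is scalar, so the order of the two factors does not affect the
result. -/
lemma lie_normalTerm {j k : ℂ} {T : Op} {a c : ℂ} {l N m : ℤ}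
    (hb : ⁅T, boson j k m⁆ = a • (1 : Op))
    (hv : ⁅T, vertex j k (N - m)⁆ = c • vertex j k (N - m + l)) :
    ⁅T, normalTerm j k N m⁆ = a • vertex j k (N - m) + c • normalTerm j k (N + l) m := by
  rw [normalTerm, normalTerm, show N + l - m = N - m + l by ring]
  split_ifs
  · rw [lie_mul, hb, hv, smul_mul_assoc, mul_smul_comm, mul_one, add_comm]
  · rw [lie_mul, hb, hv, smul_mul_assoc, mul_smul_comm, one_mul]

lemma lie_mode_current {j k : ℂ} (hk : k ≠ 0) (i : Fin 3) (l N : ℤ) :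
    ⁅mode j k i l, current j k N⁆ =
      curNorm k i l • vertex j k (N + l) + (charge i * oddInd l) • current j k (N + l) := by
  rw [current, lie_tsum (summable_normalTerm j k N)]
  simp only [fun m => lie_normalTerm (lie_mode_boson j k i l m) (lie_mode_vertex hk i l (N - m))]
  have h1 : HasSum (fun m : ℤ => (if l + m = 0 then curNorm k i l else 0) • vertex j k (N - m))
      (curNorm k i l • vertex j k (N + l)) := by
    convert hasSum_single (-l) fun m hm => ?_ using 1
    · simp
    · rw [if_neg (by omega), zero_smul]
  exact (h1.add ((summable_normalTerm j k (N + l)).hasSum.const_smul _)).tsum_eq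

lemma lie_boson_current {j k : ℂ} (hk : k ≠ 0) (l N : ℤ) :
    ⁅boson j k l, current j k N⁆ =
      (curNorm k 1 l + curNorm k 2 l) • vertex j k (N + l) +
        (-4 * oddInd l) • current j k (N + l) := by
  rw [boson, DField, DField, add_lie, lie_mode_current hk, lie_mode_current hk]
  simp only [charge, Matrix.cons_val, add_smul, zero_mul, zero_smul]
  abel

/-- Vertex modes commute, so only the brackets with the modes of A, under which V has charge -4,
survive. -/
lemma lie_vertex_current {j k : ℂ} (hk : k ≠ 0) (l N : ℤ) :
    ⁅vertex j k l, current j k N⁆ =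
      ∑' m : ℤ, (4 * oddInd m) • (vertex j k (N - m) * vertex j k (l + m)) := by
  rw [current, lie_tsum (summable_normalTerm j k N)]
  refine tsum_congr fun m => ?_
  have hb : ⁅vertex j k l, boson j k m⁆ = (4 * oddInd m) • vertex j k (l + m) := by
    rw [← lie_skew, lie_boson_vertex hk, ← op_neg_smul, neg_mul, neg_neg]
  rw [normalTerm]
  split_ifs
  · rw [lie_mul, lie_vertex_vertex hk, zero_mul, zero_add, hb, mul_smul_comm]
  · rw [lie_mul, lie_vertex_vertex hk, mul_zero, add_zero, hb, smul_mul_assoc, vertex_mul_comm hk]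

lemma oddInd_sub (l m : ℤ) : oddInd m - oddInd (-l - m) = -(oddInd l * (-1) ^ m) := by
  unfold oddInd
  rcases Int.even_or_odd l with hl | hl <;> rcases Int.even_or_odd m with hm | hm <;>
    simp [hl, hm, Int.odd_sub, Int.not_odd_iff_even.mpr, Int.not_even_iff_odd.mpr,
      Even.neg_one_zpow, Odd.neg_one_zpow]

/-- Each bracket is a sum of products of vertex modes over odd indices only. In the difference these
indicators combine by `oddInd_sub` to the alternating weight (-1)^m, so V(ζ)V(-ζ) = 1 makes the
result scalar. -/
lemma lie_vertex_current_sub {j k : ℂ} (hk : k ≠ 0) (hk' : k ≠ -2) (l M N : ℤ) :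
    ⁅vertex j k (M + l), current j k N⁆ - ⁅vertex j k (N + l), current j k M⁆ =
      (if M + N + l = 0 then 4 * oddInd l * (-1) ^ M else 0) • (1 : Op) := by
  rw [lie_vertex_current hk, lie_vertex_current hk,
    -- The reflection m ↦ -l - m makes the products in the two sums agree, after commuting the
    -- factors.
    ← (Equiv.subLeft (-l)).tsum_eq
      fun m => (4 * oddInd m) • (vertex j k (M - m) * vertex j k (N + l + m))]
  have e (m : ℤ) : (4 * oddInd (-l - m)) •
      (vertex j k (M - (-l - m)) * vertex j k (N + l + (-l - m))) =
      (4 * oddInd (-l - m)) • (vertex j k (N - m) * vertex j k (M + l + m)) := by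
    rw [vertex_mul_comm hk, show M - (-l - m) = M + l + m by ring,
      show N + l + (-l - m) = N - m by ring]
  simp only [Equiv.subLeft_apply, e]
  rw [← Summable.tsum_sub (summable_vertex_mul hk _ _ _) (summable_vertex_mul hk _ _ _)]
  simp only [← op_sub_smul, ← mul_sub, oddInd_sub]
  have e' (m : ℤ) : (4 * -(oddInd l * (-1) ^ m)) • (vertex j k (N - m) * vertex j k (M + l + m)) =
      (-4 * oddInd l) • ((-1 : ℂ) ^ m) • (vertex j k (N - m) * vertex j k (M + l + m)) := by
    rw [smul_smul]
    ring_nf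
  simp only [e']
  rw [tsum_const_smul'', tsum_neg_one_pow_vertex_mul hk hk', smul_smul]
  congr 1
  by_cases h : M + N + l = 0
  · rw [if_pos h, if_pos (by omega)]
    obtain rfl : N = -(M + l) := by omega
    rw [zpow_neg, neg_one_zpow_add]
    unfold oddInd
    split_ifs with hl
    · rw [hl.neg_one_zpow]
      rcases Int.even_or_odd M with hM | hM <;> simp [hM.neg_one_zpow]
    · simp
  · rw [if_neg h, if_neg (by omega), mul_zero]

/-! ### The commutator of two currents on the vacuum -/

lemma lie_apply_op (S T : Op) (v : Fock) : ⁅S, T⁆ v = S (T v) - T (S v) := rfl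

lemma mul_apply_eq_sub_lie (S T : Op) (v : Fock) : S (T v) = T (S v) - ⁅T, S⁆ v := by
  rw [lie_apply_op]
  abel

lemma boson_zero (j k : ℂ) : boson j k 0 = (2 * j) • (1 : Op) := by
  rw [boson, DField, DField, mode_one_zero, mode_eq_zero j k (i := 2) (by simp), add_zero]

lemma normalTerm_apply_one (j k : ℂ) {N m : ℤ} (hm : 0 < m ∨ m < N) :
    normalTerm j k N m 1 = 0 := by
  rw [normalTerm]
  split_ifs
  · rw [Module.End.mul_apply, apply_one_eq_zero (boson_mem_lowering j k m) (by omega), map_zero]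
  · rw [Module.End.mul_apply, apply_one_eq_zero (vertex_mem_lowering j k _) (by omega), map_zero]

lemma current_zero_apply_one (j k : ℂ) : current j k 0 1 = (2 * j) • (1 : Fock) := by
  rw [current, tsum_apply_eq_sum_of_eq_zero (summable_normalTerm j k 0) {0}]
  · rw [Finset.sum_singleton, normalTerm, if_neg (lt_irrefl 0), sub_zero, Module.End.mul_apply,
      vertex_zero_apply_one, boson_zero]
    rfl
  · intro m hm
    rw [Finset.mem_singleton] at hm
    exact normalTerm_apply_one j k (by omega)

/-- All other normally ordered terms have a factor of positive degree acting first on the vacuum. -/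
lemma current_neg_apply_one (j k : ℂ) (M : ℕ) :
    current j k (-M) 1 =
      ∑ n ∈ Finset.range (M + 1), boson j k (-n) (vertex j k (n - M) 1) := by
  classical
  rw [current, tsum_apply_eq_sum_of_eq_zero (summable_normalTerm j k _)
    ((Finset.range (M + 1)).image fun n : ℕ => -(n : ℤ)), Finset.sum_image]
  · refine Finset.sum_congr rfl fun n _ => ?_
    rw [normalTerm, if_neg (by omega), Module.End.mul_apply,
      show -(M : ℤ) - -(n : ℤ) = n - M by ring]
  · intro a _ b _ h
    simpa using h
  · intro m hm
    refine normalTerm_apply_one j k ?_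
    by_contra! h
    refine hm (Finset.mem_image.mpr ⟨(-m).toNat, ?_, ?_⟩)
    · rw [Finset.mem_range]; omega
    · omega

lemma lie_vertex_current_apply_one {j k : ℂ} (hk : k ≠ 0) (a : ℤ) :
    ⁅vertex j k (-a), current j k a⁆ 1 = (4 * oddInd a) • (1 : Fock) := by
  rw [lie_vertex_current hk]
  exact tsum_vertex_mul_apply_one hk (fun m => 4 * oddInd m) a

lemma current_vertex_apply_one {j k : ℂ} (hk : k ≠ 0) {a : ℤ} (ha : 0 ≤ a) :
    current j k a (vertex j k (-a) 1) =
      (if a = 0 then 2 * j else -4 * oddInd a) • (1 : Fock) := by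
  split_ifs with h
  · rw [h, neg_zero, vertex_zero_apply_one, current_zero_apply_one]
  · rw [mul_apply_eq_sub_lie, apply_one_eq_zero (current_mem_lowering j k a) (by omega), map_zero,
      zero_sub, lie_vertex_current_apply_one hk, neg_mul, neg_smul]

lemma oddInd_neg (l : ℤ) : oddInd (-l) = oddInd l := by
  simp [oddInd]

lemma curNorm_neg (k : ℂ) (i : Fin 3) (l : ℤ) : curNorm k i (-l) = -curNorm k i l := by
  simp only [curNorm, even_neg]
  split_ifs
  · push_cast
    ring
  · rw [neg_zero]

/-- J_M is moved to the right until it kills the vacuum. Passing A_{-n} gives the `curNorm` terms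
and the product of charges -16; the terms in j come from the zero mode A_0 = 2j, at n = 0, and from
J_0 on the vacuum, at n = M. -/
lemma current_boson_vertex_apply_one {j k : ℂ} (hk : k ≠ 0) {M n : ℕ} (hn : n ≤ M) (hM : 0 < M) :
    current j k M (boson j k (-n) (vertex j k (n - M) 1)) =
      ((if n = 0 then -(8 * j * oddInd M) else 0) +
        (if n = M then curNorm k 1 M + curNorm k 2 M + 8 * j * oddInd M else 0) -
        16 * (oddInd n * oddInd (M - n))) • (1 : Fock) := by
  have h1 : boson j k (-n) (current j k M (vertex j k (n - M) 1)) =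
      (if n = 0 then -(8 * j * oddInd M) else 0) • (1 : Fock) := by
    rw [mul_apply_eq_sub_lie (current j k M),
      apply_one_eq_zero (current_mem_lowering j k M) (by omega), map_zero, zero_sub]
    split_ifs with h
    · rw [h, Nat.cast_zero, zero_sub, lie_vertex_current_apply_one hk, neg_zero, boson_zero,
        LinearMap.smul_apply, Module.End.one_apply, ← neg_smul, smul_smul]
      congr 1
      ring
    · rw [apply_one_eq_zero (lie_mem_lowering (vertex_mem_lowering j k _)
        (current_mem_lowering j k M)) (by omega), neg_zero, map_zero, zero_smul]
  have h2 : ⁅boson j k (-n), current j k M⁆ (vertex j k (n - M) 1) =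
      ((if n = M then -(curNorm k 1 M + curNorm k 2 M) else 0) +
        -4 * oddInd n * (if n = M then 2 * j else -4 * oddInd (M - n))) • (1 : Fock) := by
    have e1 : (M : ℤ) + -n = M - n := by ring
    have e2 : (n : ℤ) - M = -(M - n) := by ring
    have e3 : (M : ℤ) - n = 0 ↔ n = M := by omega
    have h := vertex_mul_apply_one (j := j) hk ((M : ℤ) - n)
    rw [Module.End.mul_apply] at h
    rw [lie_boson_current hk, LinearMap.add_apply, LinearMap.smul_apply, LinearMap.smul_apply, e1,
      e2, h, current_vertex_apply_one hk (by omega), oddInd_neg, curNorm_neg, curNorm_neg]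
    rw [smul_smul, show (if (M : ℤ) - n = 0 then (1 : Fock) else 0) =
      (if (M : ℤ) - n = 0 then (1 : ℂ) else 0) • (1 : Fock) by rw [ite_smul, one_smul, zero_smul],
      smul_smul, ← add_smul]
    simp only [e3]
    refine congrArg (· • (1 : Fock)) ?_
    split_ifs with hnM
    · rw [hnM]
      ring
    · ring
  rw [mul_apply_eq_sub_lie, h1, h2, ← sub_smul]
  congr 1
  by_cases hnM : n = M
  · have : oddInd 0 = 0 := by simp [oddInd]
    simp only [hnM, if_true, sub_self, this]
    ring
  · simp only [hnM, if_false]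
    ring

lemma sum_oddInd (r : ℕ) : ∑ n ∈ Finset.range (2 * r + 1), oddInd n = r := by
  induction r with
  | zero => simp [oddInd]
  | succ r ih =>
    have h1 : Odd (2 * (r : ℤ) + 1) := ⟨r, rfl⟩
    rw [show 2 * (r + 1) + 1 = 2 * r + 1 + 1 + 1 by ring, Finset.sum_range_succ,
      Finset.sum_range_succ, ih]
    push_cast
    simp [oddInd, h1]

lemma sum_oddInd_mul (M : ℕ) :
    ∑ n ∈ Finset.range (M + 1), oddInd n * oddInd (M - n) = if Even M then (M : ℂ) / 2 else 0 := by
  split_ifs with hM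
  · obtain ⟨r, rfl⟩ := hM
    rw [← two_mul]
    calc _ = ∑ n ∈ Finset.range (2 * r + 1), oddInd n := by
          refine Finset.sum_congr rfl fun n _ => ?_
          rcases Int.even_or_odd n with h | h <;>
            simp [oddInd, h, Int.odd_sub, Int.not_odd_iff_even.mpr, Int.not_even_iff_odd.mpr]
      _ = _ := by
          rw [sum_oddInd]
          push_cast
          ring
  · refine Finset.sum_eq_zero fun n _ => ?_
    have hM' : Odd (M : ℤ) := by exact_mod_cast Nat.not_even_iff_odd.mp hM
    rcases Int.even_or_odd n with h | h <;>
      simp [oddInd, h, hM', Int.odd_sub, Int.not_odd_iff_even.mpr, Int.not_even_iff_odd.mpr]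

/-- For even M the subtracted 8M turns 4(k + 2)M into 4kM; for odd M only φ₂ contributes, giving
-4kM. The norm of φ₁ must therefore be 4(k + 2). -/
lemma curNorm_one_add_two (k : ℂ) (M : ℕ) :
    curNorm k 1 M + curNorm k 2 M - 16 * (if Even M then (M : ℂ) / 2 else 0) =
      4 * (-1 : ℂ) ^ (M : ℤ) * (k * M) := by
  rw [zpow_natCast]
  by_cases hM : Even M
  · have : Even (M : ℤ) := by exact_mod_cast hM
    simp [curNorm, hM, hM.neg_one_pow]
    ring
  · have hM' : ¬Even (M : ℤ) := by exact_mod_cast hM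
    simp [curNorm, hM, (Nat.not_even_iff_odd.mp hM).neg_one_pow]
    ring

/-- In the sum over n the j-dependent terms at n = 0 and n = M cancel. -/
lemma current_current_apply_one {j k : ℂ} (hk : k ≠ 0) {M : ℕ} (hM : 0 < M) :
    current j k M (current j k (-M) 1) = (4 * (-1 : ℂ) ^ (M : ℤ) * (k * M)) • (1 : Fock) := by
  rw [current_neg_apply_one, map_sum, Finset.sum_congr rfl fun n hn =>
    current_boson_vertex_apply_one hk (Nat.lt_succ_iff.mp (Finset.mem_range.mp hn)) hM,
    ← Finset.sum_smul, Finset.sum_sub_distrib, Finset.sum_add_distrib, Finset.sum_ite_eq',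
    Finset.sum_ite_eq', ← Finset.mul_sum, sum_oddInd_mul, if_pos (by simp), if_pos (by simp),
    ← curNorm_one_add_two]
  congr 1
  ring

/-! ### The commutation relations of the currents -/

/-- The difference of the two sides of the commutation relation of the currents. -/
def defect (j k : ℂ) (p : ℤ × ℤ) : Op :=
  ⁅current j k p.1, current j k p.2⁆ +
    (4 * (-1 : ℂ) ^ p.1) • (mode j k 0 (p.1 + p.2) -
      (if p.1 + p.2 = 0 then k * p.1 else 0) • (1 : Op))

lemma ite_smul_one_mem_lowering (n : ℤ) (r : ℂ) :
    (if n = 0 then r else 0) • (1 : Op) ∈ lowering n := by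
  split_ifs with h
  · rw [h]
    exact Submodule.smul_mem _ _ one_mem_lowering
  · rw [zero_smul]
    exact zero_mem _

lemma ite_smul_one_mem_graded (n : ℤ) (r : ℂ) :
    (if n = 0 then r else 0) • (1 : Op) ∈ graded n := by
  split_ifs with h
  · rw [h]
    exact Submodule.smul_mem _ _ one_mem_graded
  · rw [zero_smul]
    exact zero_mem _

lemma defect_mem_lowering (j k : ℂ) (p : ℤ × ℤ) : defect j k p ∈ lowering (p.1 + p.2) :=
  add_mem (lie_mem_lowering (current_mem_lowering _ _ _) (current_mem_lowering _ _ _))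
    (Submodule.smul_mem _ _ (sub_mem (mode_mem_lowering _ _ _ _) (ite_smul_one_mem_lowering _ _)))

lemma defect_mem_graded (j k : ℂ) (p : ℤ × ℤ) : defect j k p ∈ graded (p.1 + p.2) :=
  add_mem (lie_mem_graded (current_mem_graded _ _ _) (current_mem_graded _ _ _))
    (Submodule.smul_mem _ _ (sub_mem (mode_mem_graded _ _ _ _) (ite_smul_one_mem_graded _ _)))

lemma lie_smul_one (T : Op) (r : ℂ) : ⁅T, r • (1 : Op)⁆ = 0 := by
  rw [op_lie_smul, LieRing.of_associative_ring_bracket, mul_one, one_mul, sub_self, smul_zero]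

/-- By the Jacobi identity the vertex contributions form exactly the difference evaluated in
`lie_vertex_current_sub`. -/
lemma lie_mode_lie_current {j k : ℂ} (hk : k ≠ 0) (hk' : k ≠ -2) (i : Fin 3) (l M N : ℤ) :
    ⁅mode j k i l, ⁅current j k M, current j k N⁆⁆ =
      (if M + N + l = 0 then curNorm k i l * (4 * oddInd l * (-1 : ℂ) ^ M) else 0) • (1 : Op) +
        (charge i * oddInd l) • (⁅current j k (M + l), current j k N⁆ +
          ⁅current j k M, current j k (N + l)⁆) := by
  have e : ⁅mode j k i l, ⁅current j k M, current j k N⁆⁆ =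
      curNorm k i l •
        (⁅vertex j k (M + l), current j k N⁆ - ⁅vertex j k (N + l), current j k M⁆) +
        (charge i * oddInd l) • (⁅current j k (M + l), current j k N⁆ +
          ⁅current j k M, current j k (N + l)⁆) := by
    rw [leibniz_lie, lie_mode_current hk, lie_mode_current hk, add_lie, lie_add, op_smul_lie,
      op_smul_lie, op_lie_smul, op_lie_smul, ← lie_skew (current j k M) (vertex j k (N + l)),
      op_smul_sub, smul_add, smul_neg]
    abel
  rw [e, lie_vertex_current_sub hk hk', smul_smul]
  congr 2
  split_ifs <;> simp

/-- For odd l the sign (-1)^(M + l) = -(-1)^M cancels the two φ₀ modes on the right, leaving a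
scalar proportional to kl. It matches the Heisenberg bracket with φ₀ when i = 0 and the vertex
contribution when i = 2. -/
lemma lie_mode_defect {j k : ℂ} (hk : k ≠ 0) (hk' : k ≠ -2) (i : Fin 3) (l M N : ℤ) :
    ⁅mode j k i l, defect j k (M, N)⁆ =
      (charge i * oddInd l) • (defect j k (M + l, N) + defect j k (M, N + l)) := by
  have hs : l + (M + N) = 0 ↔ M + N + l = 0 := by omega
  have h1 : ⁅mode j k i l, defect j k (M, N)⁆ =
      (if M + N + l = 0 then curNorm k i l * (4 * oddInd l * (-1 : ℂ) ^ M) else 0) • (1 : Op) +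
        (charge i * oddInd l) • (⁅current j k (M + l), current j k N⁆ +
          ⁅current j k M, current j k (N + l)⁆) + (4 * (-1 : ℂ) ^ M) •
        if i = 0 ∧ M + N + l = 0 ∧ (Even l ↔ i = 1) then (bosonNorm k i * l) • (1 : Op) else 0 := by
    rw [defect, lie_add, lie_mode_lie_current hk hk', op_lie_smul, lie_sub, lie_smul_one, sub_zero,
      lie_mode_mode]
    simp only [hs]
  rw [h1]
  rcases Int.even_or_odd l with hl | hl
  · have h0 : oddInd l = 0 := by simp [oddInd, hl]
    have h3 : ¬(i = 0 ∧ M + N + l = 0 ∧ (Even l ↔ i = 1)) := by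
      rintro ⟨rfl, -, h⟩
      simp [hl] at h
    rw [if_neg h3]
    simp [h0]
  · have h0 : oddInd l = 1 := by simp [oddInd, hl]
    have hl' : ¬Even l := Int.not_even_iff_odd.mpr hl
    have h2 : defect j k (M + l, N) + defect j k (M, N + l) =
        ⁅current j k (M + l), current j k N⁆ + ⁅current j k M, current j k (N + l)⁆ +
          (if M + N + l = 0 then 4 * (-1 : ℂ) ^ M * (k * l) else 0) • (1 : Op) := by
      have e (t a b : ℂ) (P : Op) : (-t) • (P - a • (1 : Op)) + t • (P - b • (1 : Op)) =
          (t * (a - b)) • (1 : Op) := by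
        rw [op_neg_smul, op_smul_sub, op_smul_sub, smul_smul, smul_smul, mul_sub, op_sub_smul]
        abel
      simp only [defect, show M + l + N = M + N + l by ring, ← add_assoc M N l]
      rw [add_add_add_comm, neg_one_zpow_add, hl.neg_one_zpow, mul_neg_one, mul_neg, e]
      congr 2
      split_ifs
      · push_cast
        ring
      · ring
    rw [h2, h0, mul_one, mul_one]
    generalize ⁅current j k (M + l), current j k N⁆ + ⁅current j k M, current j k (N + l)⁆ = B
    rw [smul_add, add_right_comm, add_comm _ (charge i • B), smul_smul]
    congr 1
    by_cases h : M + N + l = 0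
    · fin_cases i
      · simp only [h, hl', bosonNorm, charge, curNorm, if_true, Fin.zero_eta,
          zero_ne_one, true_and, iff_self, Matrix.cons_val, smul_smul, ← add_smul]
        congr 1
        ring
      · simp [h, hl', charge, curNorm]
      · simp [h, hl', charge, curNorm]
        rw [← op_neg_smul]
        congr 1
        ring
    · simp [h]

lemma defect_diag_apply_one {j k : ℂ} (hk : k ≠ 0) (M : ℤ) : defect j k (M, -M) 1 = 0 := by
  have hpos (M : ℕ) (hM : 0 < M) : defect j k (M, -M) 1 = 0 := by
    rw [defect, LinearMap.add_apply, lie_apply_op, current_current_apply_one hk hM,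
      apply_one_eq_zero (current_mem_lowering j k M) (by omega), map_zero, sub_zero,
      add_neg_cancel, if_pos rfl, mode_eq_zero j k (i := 0) (by simp), zero_sub]
    simp only [LinearMap.smul_apply, LinearMap.neg_apply, Module.End.one_apply, Int.cast_natCast]
    rw [smul_neg, smul_smul, add_neg_cancel]
  -- Antisymmetry on the diagonal, where the φ₀ term is an even mode and hence zero; it reduces the
  -- claim to M ≥ 0.
  have hneg (M : ℤ) : defect j k (-M, M) = -defect j k (M, -M) := by
    simp only [defect, ← lie_skew (current j k (-M)), neg_add_cancel, add_neg_cancel, if_true,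
      mode_eq_zero j k (i := 0) (n := 0) (by simp), zero_sub, smul_neg, smul_smul, zpow_neg]
    have hi : ((-1 : ℂ) ^ M)⁻¹ = (-1) ^ M := by
      rcases Int.even_or_odd M with hM | hM <;> simp [hM.neg_one_zpow]
    rw [hi, Int.cast_neg, mul_neg, mul_neg, op_neg_smul, neg_add]
  obtain ⟨n, rfl | rfl⟩ := M.eq_nat_or_neg
  · rcases n.eq_zero_or_pos with rfl | hn
    · simp [defect, mode_eq_zero]
    · exact hpos n hn
  · rcases n.eq_zero_or_pos with rfl | hn
    · simp [defect, mode_eq_zero]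
    · rw [neg_neg, hneg, LinearMap.neg_apply, hpos n hn, neg_zero]

/-- An annihilation mode φ_{i,l} sends the vector to a multiple of a sum of vectors of the same kind
whose weight is lower by l. By induction these vanish, so off the diagonal the vector is singular of
nonzero weight. -/
lemma defect_apply_one {j k : ℂ} (hk : k ≠ 0) (hk' : k ≠ -2) (p : ℤ × ℤ) : defect j k p 1 = 0 := by
  suffices ∀ d : ℕ, ∀ M N : ℤ, -(M + N) < d → defect j k (M, N) 1 = 0 from
    this ((-(p.1 + p.2)).toNat + 1) p.1 p.2 (by omega)
  intro d
  induction d with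
  | zero =>
    intro M N h
    -- Here M + N > 0, so the vacuum would be sent to negative weight.
    exact apply_one_eq_zero (defect_mem_lowering j k (M, N)) (by simp only; omega)
  | succ d ih =>
    intro M N h
    by_cases h0 : M + N = 0
    · obtain rfl : N = -M := by omega
      exact defect_diag_apply_one hk M
    refine eq_zero_of_mode_eq_zero (j := j) hk hk' (neg_ne_zero.mpr (Int.cast_ne_zero.mpr h0))
      (fun i l hl => ?_) (weightOp_apply_one (defect_mem_graded j k (M, N)))
    have e := LinearMap.congr_fun (lie_mode_defect (j := j) hk hk' i l M N) 1
    rw [lie_apply_op, mode_vacuum j k i hl, map_zero, sub_zero] at e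
    rw [e, LinearMap.smul_apply, LinearMap.add_apply, ih _ _ (by omega), ih _ _ (by omega),
      add_zero, smul_zero]

lemma defect_eq_zero {j k : ℂ} (hk : k ≠ 0) (hk' : k ≠ -2) (p : ℤ × ℤ) : defect j k p = 0 := by
  refine eq_zero_of_lie_mode (j := j) (k := k) (defect_apply_one hk hk') (fun p i l => ?_) p
  rw [lie_mode_defect hk hk']
  exact Submodule.smul_mem _ _ (add_mem (Submodule.subset_span ⟨_, rfl⟩)
    (Submodule.subset_span ⟨_, rfl⟩))

lemma lie_xOp_xOp {j k : ℂ} (hk : k ≠ 0) (hk' : k ≠ -2) (m n : ℤ) :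
    ⁅xOp j k m, xOp j k n⁆ = (-2 * (-1 : ℂ) ^ m) • βOp j k (m + n) +
      (if m + n = 0 then k * m * (-1 : ℂ) ^ m else 0) • (1 : Op) := by
  have h := defect_eq_zero (j := j) hk hk' (m, n)
  rw [defect, add_eq_zero_iff_eq_neg] at h
  rw [xOp_eq, xOp_eq, op_smul_lie, op_lie_smul, h, βOp, DField]
  simp only [neg_sub, op_smul_sub, smul_smul]
  rw [sub_eq_neg_add, ← op_neg_smul]
  congr 2
  · ring
  · split_ifs <;> ring

lemma lie_βOp_xOp {j k : ℂ} (hk : k ≠ 0) (m n : ℤ) :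
    ⁅βOp j k m, xOp j k n⁆ = (2 * oddInd m) • xOp j k (m + n) := by
  rw [xOp_eq, xOp_eq, βOp, DField, op_smul_lie, op_lie_smul, lie_mode_current hk, add_comm n m]
  have : curNorm k 0 m = 0 := by simp [curNorm]
  rw [this, zero_smul, zero_add]
  simp only [smul_smul, charge, Matrix.cons_val_zero]
  congr 1
  ring

lemma lie_βOp_βOp (j k : ℂ) (m n : ℤ) :
    ⁅βOp j k m, βOp j k n⁆ = (if m + n = 0 then k * m * oddInd m else 0) • (1 : Op) := by
  rw [βOp, βOp, DField, DField, op_smul_lie, op_lie_smul, lie_mode_mode]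
  by_cases h : m + n = 0
  · by_cases hm : Even m
    · simp [h, oddInd, hm]
    · simp only [h, hm, oddInd, Int.not_even_iff_odd.mp hm]
      simp [smul_smul, bosonNorm]
      ring
  · simp [h]

/-! ### Generators of the affine Lie algebra -/

/-- The loop component. -/
def loopMap : Ambient →ₗ[ℂ] Loop where
  toFun := Ambient.loop
  map_add' _ _ := rfl
  map_smul' _ _ := rfl

/-- The coefficient of `c`. -/
def cenMap : Ambient →ₗ[ℂ] ℂ where
  toFun := Ambient.cen
  map_add' _ _ := rfl
  map_smul' _ _ := rfl

/-- The coefficient of `ρ`. -/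
def derMap : Ambient →ₗ[ℂ] ℂ where
  toFun := Ambient.der
  map_add' _ _ := rfl
  map_smul' _ _ := rfl

/-- The inclusion of the loop algebra. -/
def loopIncl : Loop →ₗ[ℂ] Ambient where
  toFun g := ⟨g, 0, 0⟩
  map_add' _ _ := by ext1 <;> simp
  map_smul' _ _ := by ext1 <;> simp

/-- The generators `β_n`, `x_n`, `c`, `ρ`. -/
def generators : Set affineSl2 :=
  {y | ∃ n, ∃ hn : Odd n, y = βElt n hn} ∪ Set.range xElt ∪ {c, ρ}

lemma βElt_mem_generators (n : ℤ) (hn : Odd n) : βElt n hn ∈ generators := .inl (.inl ⟨n, hn, rfl⟩)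
lemma xElt_mem_generators (n : ℤ) : xElt n ∈ generators := .inl (.inr ⟨n, rfl⟩)
lemma c_mem_generators : c ∈ generators := .inr (.inl rfl)
lemma ρ_mem_generators : ρ ∈ generators := .inr (.inr rfl)

lemma monom_mem_span (m : ℤ) (a : Mat) (ha : a ∈ grade m) :
    monom m a ha ∈ Submodule.span ℂ generators := by
  by_cases hm : Even m
  · obtain ⟨r, rfl⟩ := Submodule.mem_span_singleton.mp (by simpa [grade, hm] using ha)
    have e : monom m (r • h) ha = r • xElt m := by
      apply Subtype.ext
      ext1 <;> simp [xElt, monom, hm, AddMonoidAlgebra.smul_single,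
        -LaurentPolynomial.single_eq_C_mul_T]
    rw [e]
    exact Submodule.smul_mem _ _ (Submodule.subset_span (xElt_mem_generators m))
  · obtain ⟨u, v, rfl⟩ := Submodule.mem_span_pair.mp (by simpa [grade, hm] using ha)
    have hm' := Int.not_even_iff_odd.mp hm
    have e' : u • e + v • f = ((u + v) / 2) • (e + f) + ((v - u) / 2) • (-e + f) := by
      module
    have e : monom m (u • e + v • f) ha =
        ((u + v) / 2) • βElt m hm' + ((v - u) / 2) • xElt m := by
      apply Subtype.ext
      ext1
      · simp only [xElt, βElt, monom, hm, if_false, AddMemClass.coe_add, SetLike.val_smul,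
          Ambient.add_loop, Ambient.smul_loop, AddMonoidAlgebra.smul_single,
          ← AddMonoidAlgebra.single_add, e']
      all_goals simp [xElt, βElt, monom]
    rw [e]
    exact add_mem (Submodule.smul_mem _ _ (Submodule.subset_span (βElt_mem_generators m hm')))
      (Submodule.smul_mem _ _ (Submodule.subset_span (xElt_mem_generators m)))

/-- A linear spanning set, not merely a set of Lie generators: both the bracket check and uniqueness
then follow by linearity. -/
lemma span_generators : Submodule.span ℂ generators = ⊤ := by
  rw [eq_top_iff]
  rintro ⟨x, hx⟩ -
  have hx : x.loop ∈ principalLoop := hx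
  suffices x ∈ (Submodule.span ℂ generators).map affineSl2.toSubmodule.subtype by
    obtain ⟨y, hy, rfl⟩ := this
    exact hy
  have e : x = loopIncl x.loop + x.cen • (c : Ambient) + x.der • (ρ : Ambient) := by
    ext1 <;> simp [loopIncl, c, ρ]
  rw [e]
  refine add_mem (add_mem ?_ (Submodule.smul_mem _ _
    ⟨c, Submodule.subset_span c_mem_generators, rfl⟩)) (Submodule.smul_mem _ _
    ⟨ρ, Submodule.subset_span ρ_mem_generators, rfl⟩)
  rw [← AddMonoidAlgebra.sum_coeff_single x.loop, Finsupp.sum, map_sum]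
  exact sum_mem fun m _ => ⟨_, monom_mem_span m _ (hx m), rfl⟩

/-! ### The representation -/

lemma βOp_of_even (j k : ℂ) {m : ℤ} (hm : Even m) : βOp j k m = 0 := by
  rw [βOp, DField, mode_eq_zero j k (by simp [hm]), smul_zero]

/-- The operator by which `a ⊗ t ^ m` acts. -/
def monomMap (j k : ℂ) (m : ℤ) : Mat →ₗ[ℂ] Op where
  -- For odd m these are the coordinates in the basis e + f, -e + f; for even m the β term is zero
  -- and `a 0 0` is the coefficient of h.
  toFun a := ((a 0 1 + a 1 0) / 2) • βOp j k m +
    (if Even m then a 0 0 else (a 1 0 - a 0 1) / 2) • xOp j k m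
  map_add' a b := by
    split_ifs <;> simp only [Matrix.add_apply] <;> module
  map_smul' r a := by
    split_ifs <;> simp only [Matrix.smul_apply, smul_eq_mul, RingHom.id_apply] <;> module

/-- The linear map underlying the representation. -/
def repMap (j k : ℂ) : Ambient →ₗ[ℂ] Op :=
  (Finsupp.lsum ℂ (monomMap j k)) ∘ₗ (AddMonoidAlgebra.coeffLinearEquiv ℂ).toLinearMap ∘ₗ loopMap +
    cenMap.smulRight (k • (1 : Op)) + derMap.smulRight (-gradingOp j k)

lemma repMap_apply (j k : ℂ) (x : Ambient) : repMap j k x =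
    Finsupp.lsum ℂ (monomMap j k) (AddMonoidAlgebra.coeffLinearEquiv ℂ x.loop) +
      x.cen • (k • (1 : Op)) + x.der • (-gradingOp j k) := rfl

lemma repMap_monom (j k : ℂ) (m : ℤ) (a : Mat) (ha : a ∈ grade m) :
    repMap j k (monom m a ha) = monomMap j k m a := by
  rw [repMap_apply]
  simp only [monom, zero_smul, add_zero]
  exact Finsupp.lsum_single ..

lemma repMap_βElt (j k : ℂ) (n : ℤ) (hn : Odd n) : repMap j k (βElt n hn) = βOp j k n := by
  rw [βElt, repMap_monom]
  simp [monomMap, e, f, Int.not_even_iff_odd.mpr hn]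

lemma repMap_xElt (j k : ℂ) (n : ℤ) : repMap j k (xElt n) = xOp j k n := by
  rw [xElt, repMap_monom]
  by_cases hn : Even n
  · simp [monomMap, hn, h]
  · simp [monomMap, e, f, hn]

lemma repMap_c (j k : ℂ) : repMap j k c = k • (1 : Op) := by
  simp [repMap_apply, c]

lemma repMap_ρ (j k : ℂ) : repMap j k ρ = -gradingOp j k := by
  simp [repMap_apply, ρ]

lemma repMap_lie_monom (j k : ℂ) {m n : ℤ} {a b : Mat} (ha : a ∈ grade m) (hb : b ∈ grade n) :
    repMap j k (⁅monom m a ha, monom n b hb⁆ : affineSl2) = monomMap j k (m + n) (a * b - b * a) +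
      (if m + n = 0 then (1 / 2) * (a * b).trace * m * k else 0) • (1 : Op) := by
  rw [lie_monom, AddMemClass.coe_add, SetLike.val_smul, map_add, map_smul, repMap_monom, repMap_c,
    smul_smul, ite_mul, zero_mul]

lemma repMap_lie_βElt_βElt (j k : ℂ) {m n : ℤ} (hm : Odd m) (hn : Odd n) :
    repMap j k (⁅βElt m hm, βElt n hn⁆ : affineSl2) = ⁅βOp j k m, βOp j k n⁆ := by
  rw [βElt, βElt, repMap_lie_monom, sub_self, map_zero, zero_add, lie_βOp_βOp]
  congr 2
  simp [oddInd, hm, e, f, Matrix.trace_fin_two]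
  ring

lemma repMap_lie_βElt_xElt {j k : ℂ} (hk : k ≠ 0) {m : ℤ} (hm : Odd m) (n : ℤ) :
    repMap j k (⁅βElt m hm, xElt n⁆ : affineSl2) = ⁅βOp j k m, xOp j k n⁆ := by
  rw [βElt, xElt, repMap_lie_monom, lie_βOp_xOp hk]
  have hm' := Int.not_even_iff_odd.mpr hm
  by_cases hn : Even n
  · simp [oddInd, hm, hm', hn, e, f, h, Matrix.trace_fin_two, monomMap, Int.even_add]
    norm_num
  · simp [oddInd, hm, hm', hn, e, f, Matrix.trace_fin_two, monomMap, Int.even_add]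
    norm_num

/-- For equal parities the matrix commutator vanishes and only the central term is left; the traces
2 of h² and -2 of (-e + f)² produce the sign (-1)^m. For opposite parities m + n is odd, so there is
no central term, and ±[h, -e + f] = ∓2(e + f) gives β. -/
lemma repMap_lie_xElt_xElt {j k : ℂ} (hk : k ≠ 0) (hk' : k ≠ -2) (m n : ℤ) :
    repMap j k (⁅xElt m, xElt n⁆ : affineSl2) = ⁅xOp j k m, xOp j k n⁆ := by
  rw [xElt, xElt, repMap_lie_monom, lie_xOp_xOp hk hk']
  have hmn : m + n = 0 → (Even m ↔ Even n) := by
    intro h0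
    rw [← Int.even_add, h0]
    exact Even.zero
  by_cases hm : Even m <;> by_cases hn : Even n
  · rw [βOp_of_even j k (hm.add hn), smul_zero]
    congr 1
    · simp [hm, hn]
    · congr 2
      simp [hm, hn, h, Matrix.trace_fin_two, hm.neg_one_zpow]
      ring
  · have h0 : m + n ≠ 0 := fun h0 => hn ((hmn h0).mp hm)
    simp [hm, hn, h0, e, f, h, monomMap, Int.even_add, hm.neg_one_zpow]
    norm_num
  · have h0 : m + n ≠ 0 := fun h0 => hm ((hmn h0).mpr hn)
    simp [hm, hn, h0, e, f, h, monomMap, Int.even_add,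
      (Int.not_even_iff_odd.mp hm).neg_one_zpow]
    norm_num
  · have hm' := Int.not_even_iff_odd.mp hm
    rw [βOp_of_even j k (hm'.add_odd (Int.not_even_iff_odd.mp hn)), smul_zero]
    congr 1
    · simp [hm, hn]
    · congr 2
      simp [hm, hn, e, f, Matrix.trace_fin_two, hm'.neg_one_zpow]
      ring

lemma βOp_mem_graded (j k : ℂ) (n : ℤ) : βOp j k n ∈ graded n :=
  Submodule.smul_mem _ _ (mode_mem_graded j k 0 n)

lemma xOp_mem_graded (j k : ℂ) (n : ℤ) : xOp j k n ∈ graded n := by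
  rw [xOp_eq]
  exact Submodule.smul_mem _ _ (current_mem_graded j k n)

lemma lie_neg_gradingOp (j k : ℂ) {T : Op} {n : ℤ} (hT : T ∈ graded n) :
    ⁅-gradingOp j k, T⁆ = (n : ℂ) • T := by
  rw [neg_lie, lie_gradingOp, mem_graded.mp hT, op_neg_smul, neg_neg]

lemma repMap_lie_ρ (j k : ℂ) (y : affineSl2) (hy : y ∈ generators) :
    repMap j k (⁅ρ, y⁆ : affineSl2) = ⁅repMap j k ρ, repMap j k y⁆ := by
  rcases hy with (⟨n, hn, rfl⟩ | ⟨n, rfl⟩) | (rfl | rfl)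
  · rw [βElt, lie_ρ_monom, SetLike.val_smul, map_smul, ← βElt, repMap_βElt, repMap_ρ,
      lie_neg_gradingOp j k (βOp_mem_graded j k n)]
    exact hn
  · rw [xElt, lie_ρ_monom, SetLike.val_smul, map_smul, ← xElt, repMap_xElt, repMap_ρ,
      lie_neg_gradingOp j k (xOp_mem_graded j k n)]
  · rw [← lie_skew, lie_c, neg_zero, repMap_c, lie_smul_one, ZeroMemClass.coe_zero, map_zero]
  · rw [lie_self, lie_self, ZeroMemClass.coe_zero, map_zero]

lemma repMap_lie_swap (j k : ℂ) {x y : affineSl2}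
    (hxy : repMap j k (⁅x, y⁆ : affineSl2) = ⁅repMap j k x, repMap j k y⁆) :
    repMap j k (⁅y, x⁆ : affineSl2) = ⁅repMap j k y, repMap j k x⁆ := by
  rw [← lie_skew, ← lie_skew (repMap j k y), ← hxy, NegMemClass.coe_neg, map_neg]

lemma repMap_lie_c (j k : ℂ) (y : affineSl2) :
    repMap j k (⁅c, y⁆ : affineSl2) = ⁅repMap j k c, repMap j k y⁆ := by
  rw [lie_c, ← lie_skew, repMap_c, lie_smul_one, ZeroMemClass.coe_zero, map_zero, neg_zero]

lemma repMap_lie_generators {j k : ℂ} (hk : k ≠ 0) (hk' : k ≠ -2) {x y : affineSl2}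
    (hx : x ∈ generators) (hy : y ∈ generators) :
    repMap j k (⁅x, y⁆ : affineSl2) = ⁅repMap j k x, repMap j k y⁆ := by
  rcases hy with hy' | (rfl | rfl)
  · rcases hx with hx' | (rfl | rfl)
    · rcases hx' with ⟨m, hm, rfl⟩ | ⟨m, rfl⟩ <;> rcases hy' with ⟨n, hn, rfl⟩ | ⟨n, rfl⟩
      · rw [repMap_lie_βElt_βElt, repMap_βElt, repMap_βElt]
      · rw [repMap_lie_βElt_xElt hk, repMap_βElt, repMap_xElt]
      · refine repMap_lie_swap j k ?_
        rw [repMap_lie_βElt_xElt hk, repMap_βElt, repMap_xElt]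
      · rw [repMap_lie_xElt_xElt hk hk', repMap_xElt, repMap_xElt]
    · exact repMap_lie_c j k _
    · exact repMap_lie_ρ j k _ (.inl hy')
  · exact repMap_lie_swap j k (repMap_lie_c j k _)
  · exact repMap_lie_swap j k (repMap_lie_ρ j k _ hx)

lemma repMap_lie {j k : ℂ} (hk : k ≠ 0) (hk' : k ≠ -2) (x y : affineSl2) :
    repMap j k (⁅x, y⁆ : affineSl2) = ⁅repMap j k x, repMap j k y⁆ := by
  have hx : x ∈ Submodule.span ℂ generators := span_generators ▸ Submodule.mem_top
  have hy : y ∈ Submodule.span ℂ generators := span_generators ▸ Submodule.mem_top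
  induction hx, hy using Submodule.span_induction₂ with
  | mem_mem x y hx hy => exact repMap_lie_generators hk hk' hx hy
  | zero_left y hy => simp
  | zero_right x hx => simp
  | add_left x y z hx hy hz h1 h2 =>
    rw [add_lie, AddMemClass.coe_add, AddMemClass.coe_add, map_add, map_add, add_lie, h1, h2]
  | add_right x y z hx hy hz h1 h2 =>
    rw [lie_add, AddMemClass.coe_add, AddMemClass.coe_add, map_add, map_add, lie_add, h1, h2]
  | smul_left r x y hx hy h1 =>
    rw [smul_lie, SetLike.val_smul, SetLike.val_smul, map_smul, map_smul, op_smul_lie, h1]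
  | smul_right r x y hx hy h1 =>
    rw [lie_smul, SetLike.val_smul, SetLike.val_smul, map_smul, map_smul, op_lie_smul, h1]

/-- The representation of the affine Lie algebra on the Fock space. -/
def rep {j k : ℂ} (hk : k ≠ 0) (hk' : k ≠ -2) : affineSl2 →ₗ⁅ℂ⁆ Module.End ℂ Fock :=
  { repMap j k ∘ₗ affineSl2.toSubmodule.subtype with
    map_lie' := fun {x y} => repMap_lie hk hk' x y }

/-! ### The relations of the currents as formal series -/

/-- A kernel supported on m + l = 0 leaves a single term of the sum. -/
lemma mulRight_eq (K : ℤ → ℤ → ℂ) (b : ℤ → Op) (hK : ∀ m l, m + l ≠ 0 → K m l = 0) (m n : ℤ) :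
    mulRight K b m n = K m (-m) • b (m + n) := by
  rw [mulRight, finsum_eq_single _ (-m), sub_neg_eq_add, add_comm n m]
  intro l hl
  rw [hK m l (by omega), zero_smul]

/-- In modes, δ(z) - δ(-z) is twice the odd part of δ, matching the fact that β has odd modes only.
-/
lemma one_sub_neg_one_zpow (m : ℤ) : (1 : ℂ) - (-1) ^ m = 2 * oddInd m := by
  rcases Int.even_or_odd m with h | h
  · simp [oddInd, h, h.neg_one_zpow]
  · simp [oddInd, h, h.neg_one_zpow]
    norm_num

lemma relationBB (j k : ℂ) : RelationBB (βOp j k) k := by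
  intro m n
  rw [lieSeries]
  refine (lie_βOp_βOp j k m n).trans ?_
  congr 1
  rw [Ddelta, Ddelta]
  split_ifs
  · rw [one_zpow]
    linear_combination (-(k * m / 2)) * one_sub_neg_one_zpow m
  · ring

lemma relationBX {j k : ℂ} (hk : k ≠ 0) : RelationBX (βOp j k) (xOp j k) := by
  intro m n
  rw [lieSeries, mulRight_eq _ _ (fun m l h => by simp [delta, h])]
  refine (lie_βOp_xOp hk m n).trans ?_
  simp [delta, one_sub_neg_one_zpow]

lemma relationXX {j k : ℂ} (hk : k ≠ 0) (hk' : k ≠ -2) : RelationXX (βOp j k) (xOp j k) k := by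
  intro m n
  rw [lieSeries, mulRight_eq _ _ (fun m l h => by simp [delta, h])]
  refine (lie_xOp_xOp hk hk' m n).trans ?_
  rw [smul_smul, delta, if_pos (add_neg_cancel m), Ddelta, mul_ite, mul_zero, ← mul_assoc]

end PrincipalAffine

end

theorem mainTheorem1 (j k : ℂ) (hk : k ≠ 0) (hk' : k ≠ -2) :
    (∃! π : PrincipalAffine.affineSl2 →ₗ⁅ℂ⁆ Module.End ℂ PrincipalAffine.Fock,
      (∀ (n : ℤ) (hn : Odd n), π (PrincipalAffine.βElt n hn) = PrincipalAffine.βOp j k n) ∧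
      (∀ n : ℤ, π (PrincipalAffine.xElt n) = PrincipalAffine.xOp j k n) ∧
      π PrincipalAffine.c = k • (1 : Module.End ℂ PrincipalAffine.Fock) ∧
      π PrincipalAffine.ρ = -PrincipalAffine.gradingOp j k) ∧
    PrincipalAffine.RelationBB (PrincipalAffine.βOp j k) k ∧
    PrincipalAffine.RelationBX (PrincipalAffine.βOp j k) (PrincipalAffine.xOp j k) ∧
    PrincipalAffine.RelationXX (PrincipalAffine.βOp j k) (PrincipalAffine.xOp j k) k := by
  open PrincipalAffine in
  refine ⟨⟨rep hk hk', ⟨fun n hn => repMap_βElt j k n hn, fun n => repMap_xElt j k n,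
    repMap_c j k, repMap_ρ j k⟩, ?_⟩, relationBB j k, relationBX hk, relationXX hk hk'⟩
  rintro π ⟨hβ, hx, hc, hρ⟩
  -- Uniqueness: the prescribed values determine the underlying linear map on a spanning set.
  have h : (π : PrincipalAffine.affineSl2 →ₗ[ℂ] PrincipalAffine.Op) =
      (PrincipalAffine.rep (j := j) hk hk' :
        PrincipalAffine.affineSl2 →ₗ[ℂ] PrincipalAffine.Op) := by
    refine LinearMap.ext_on PrincipalAffine.span_generators ?_
    rintro y ((⟨n, hn, rfl⟩ | ⟨n, rfl⟩) | (rfl | rfl))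
    · exact (hβ n hn).trans (PrincipalAffine.repMap_βElt j k n hn).symm
    · exact (hx n).trans (PrincipalAffine.repMap_xElt j k n).symm
    · exact hc.trans (PrincipalAffine.repMap_c j k).symm
    · exact hρ.trans (PrincipalAffine.repMap_ρ j k).symm
  exact LieHom.ext fun y => LinearMap.congr_fun h y
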